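/- Conventions. A strict partition is a sequence $\lambda_1>\dots>\lambda_r>0$ of integers; for $n\ge r$ we also write it as a sequence of length $n$ by appending zeros. $R$ is a commutative ring with a chosen element $z$. For a power series $c=\sum_{k\ge0}c_kt^k$ over $R$ put $c_k=0$ for $k<0$. For integers $p,q$ and series $a,b$ set $$\mathrm{Pf}_p(a)=a_p,\qquad \mathrm{Pf}_{p,q}(a,b)=\sum_{0\le i\le j\le q}(-1)^j\left(\tbinom{j}{i}+\tbinom{j-1}{i}\right)z^i\,a_{p+j-i}\,b_{q-j},$$ where $\binom{-1}{0}=0$. For a sequence of integers $\lambda=(\lambda_1,\dots,\lambda_n)$ and series $c(1),\dots,c(n)$ with $c(k)_0=1$, the pseudo-pfaffian $\mathrm{Pf}_\lambda(c(1),\dots,c(n))$ is defined inductively: it is $1$ for $n=0$; for $n\geq 3$ odd it is $$\sum_{k=1}^n(-1)^{k-1}\,\mathrm{Pf}_{\lambda_k}(c(k))\,\mathrm{Pf}_{\lambda_1,\dots,\widehat{\lambda_k},\dots,\lambda_n}(c(1),\dots,\widehat{c(k)},\dots,c(n)),$$ and for $n\geq 4$ even it is $$\sum_{k=2}^n(-1)^{k}\,\mathrm{Pf}_{\lambda_1,\lambda_k}(c(1),c(k))\,\mathrm{Pf}_{\lambda_2,\dots,\widehat{\lambda_k},\dots,\lambda_n}(c(2),\dots,\widehat{c(k)},\dots,c(n)).$$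 For a sequence $\nu=(\nu_1,\dots,\nu_n)$ of nonnegative integers and an entry $k$ of $\nu$, let $i_1<\dots<i_s$ be the indices $i$ with $\nu_i=k$, set $P[\nu,k]=\mathrm{Pf}_{\lambda_{i_1}-k,\dots,\lambda_{i_s}-k}(c(i_1),\dots,c(i_s))$, and let $P[\nu]$ be the product of the $P[\nu,k]$ over the distinct entries $k$ of $\nu$. For a partition $\mu=(\mu_1\ge\dots\ge\mu_n\ge0)$, the skew pseudo-pfaffian is $$\mathrm{Pf}_{\lambda/\mu}(c(1),\dots,c(n))=\sum_{\nu}\mathrm{sgn}(\nu)\,P[\nu],$$ the sum over all distinct rearrangements $\nu$ of $\mu$, where $\mathrm{sgn}(\nu)=(-1)^{\#\{i<j\,:\,\nu_i<\nu_j\}}$. Write $\mathrm{Pf}_{\lambda/\mu}(a)$ if all $c(i)$ are equal to $a$. The shifted skew shape $\lambda/\mu$ consists of the boxes $(i,j)$ with $1\le i\le n$ and $i+\mu_i\le j<i+\lambda_i$ (row $i$, column $j$). A tableau $T$ on it is a filling of the boxes with letters from the ordered alphabet $1'<1<2'<2<\dots<m'<m$, weakly increasing along rows and down columns, with no $k$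 repeated in a column and no $k'$ repeated in a row. For $x_1,\dots,x_m,y_1,\dots,y_m\in R$, $(x,y)^T$ denotes the product, over all boxes, of $x_k$ for each entry $k$ and $y_k$ for each entry $k'$. **Proposition.** Let $\lambda\supset\mu$ be strict partitions (so $\mu_i\le\lambda_i$ for all $i$), written as sequences of a length $n$ that is at least the number of parts of $\lambda$. Let $x_1,\dots,x_m\in R$ and $y_i=x_i+z$, and let $a=\prod_{i=1}^m\frac{1+y_it}{1-x_it}$. Then $$\mathrm{Pf}_{\lambda/\mu}(a)=\sum_T(x,y)^T,$$ the sum over all tableaux $T$ on the shifted skew shape $\lambda/\mu$ with entries $1'<1<2'<2<\dots<m'<m$. -/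

import Mathlib

open scoped PowerSeries

namespace SchurPf

variable {R : Type*} [CommRing R]

/-- The coefficient `c_k` of a series `c = ∑ c_k t^k`, for any integer `k`; it is `0` for `k < 0`. -/
noncomputable def chernCoeff (c : R⟦X⟧) (k : ℤ) : R :=
  if 0 ≤ k then PowerSeries.coeff k.toNat c else 0

/-- The integer `binom(j, i) + binom(j - 1, i)`, where `binom(-1, i) = 0`. -/
def binomSum (j i : ℕ) : ℤ :=
  (j.choose i : ℤ) + if j = 0 then 0 else ((j - 1).choose i : ℤ)

/-- `Pf_{p,q}(a, b) = ∑_{0 ≤ i ≤ j ≤ q} (-1)^j (binom(j,i) + binom(j-1,i)) z^i a_{p+j-i} b_{q-j}`;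
the sum is empty for `q < 0`. -/
noncomputable def pf₂ (z : R) (p q : ℤ) (a b : R⟦X⟧) : R :=
  if 0 ≤ q then
    ∑ j ∈ Finset.range (q.toNat + 1), ∑ i ∈ Finset.range (j + 1),
      (-1) ^ j * (binomSum j i : R) * z ^ i *
        chernCoeff a (p + (j : ℤ) - (i : ℤ)) * chernCoeff b (q - (j : ℤ))
  else 0

/-- The pseudo-pfaffian `Pf_l(c(1), …, c(n))`, by expansion along the first entry for `n` even,
and along all single entries for `n` odd. The empty pseudo-pfaffian is `1`.
(Indices start at `0` here.) -/
noncomputable def pf (z : R) : (n : ℕ) → (Fin n → ℤ) → (Fin n → R⟦X⟧) → R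
  | 0, _, _ => 1
  | 1, l, c => chernCoeff (c 0) (l 0)
  | n + 2, l, c =>
    if Even n then
      ∑ k : Fin (n + 1), (-1) ^ (k : ℕ) * pf₂ z (l 0) (l k.succ) (c 0) (c k.succ) *
        pf z n (fun i => l (k.succAbove i).succ) (fun i => c (k.succAbove i).succ)
    else
      ∑ k : Fin (n + 2), (-1) ^ (k : ℕ) * chernCoeff (c k) (l k) *
        pf z (n + 1) (fun i => l (k.succAbove i)) (fun i => c (k.succAbove i))

/-- `P[v, k] = Pf_{l_{i_1} - k, …, l_{i_s} - k}(c(i_1), …, c(i_s))`, where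
`i_1 < ⋯ < i_s` are the indices `i` with `v_i = k`. -/
noncomputable def blockPf (z : R) {n : ℕ} (l : Fin n → ℤ) (c : Fin n → R⟦X⟧)
    (v : Fin n → ℕ) (k : ℕ) : R :=
  let I : Finset (Fin n) := Finset.univ.filter fun i => v i = k
  pf z I.card (fun s => l (I.orderEmbOfFin rfl s) - (k : ℤ)) (fun s => c (I.orderEmbOfFin rfl s))

/-- The number of pairs `i < j` with `v_i < v_j`: the minimal number of transpositions of
neighbours that bring `v` into weakly decreasing order. -/
def inversions {n : ℕ} (v : Fin n → ℕ) : ℕ :=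
  (Finset.univ.filter fun p : Fin n × Fin n => p.1 < p.2 ∧ v p.1 < v p.2).card

/-- The skew pseudo-pfaffian `Pf_{l/u}(c(1), …, c(n))`: the signed sum, over the distinct
rearrangements `v` of `u`, of the products of all `P[v, k]`, `k` an entry of `u`. -/
noncomputable def skewPf (z : R) {n : ℕ} (l : Fin n → ℤ) (u : Fin n → ℕ) (c : Fin n → R⟦X⟧) : R :=
  ∑ v ∈ Finset.univ.image (fun σ : Equiv.Perm (Fin n) => u ∘ σ),
    (-1) ^ inversions v * ∏ k ∈ Finset.univ.image u, blockPf z l c v k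

/-- A strict partition with at most `n` parts, written as a sequence of length `n`: the positive
entries are strictly decreasing, and they may be followed by zeros. -/
def IsStrictPartition {n : ℕ} (l : Fin n → ℕ) : Prop :=
  ∀ i j : Fin n, i < j → l j < l i ∨ (l i = 0 ∧ l j = 0)

/-- The series `∏_{i=1}^m (1 + y_i t) / (1 - x_i t)`. -/
noncomputable def quotientSeries {m : ℕ} (x y : Fin m → R) : R⟦X⟧ :=
  ∏ i, (1 + PowerSeries.C (y i) * PowerSeries.X) *
    PowerSeries.invOfUnit (1 - PowerSeries.C (x i) * PowerSeries.X) 1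

/-- The boxes of the shifted skew shape `l/u`, as pairs (row, column): row `i` of the shifted
diagram of `l` starts at column `i` and has `l_i` boxes. -/
def shiftedSkewShape {n : ℕ} (l u : Fin n → ℕ) : Finset ((_ : Fin n) × ℕ) :=
  Finset.univ.sigma fun i => Finset.Ico ((i : ℕ) + u i) ((i : ℕ) + l i)

/-- The ordered alphabet `1' < 1 < 2' < 2 < ⋯ < m' < m`: the pair `(k, false)` is the primed
letter `k'`, and `(k, true)` is the unprimed letter `k`. -/
abbrev Letter (m : ℕ) : Type := Fin m ×ₗ Bool

/-- The letter is unprimed. -/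
def Letter.IsPlain {m : ℕ} (e : Letter m) : Prop := (ofLex e).2 = true

/-- The letter is primed. -/
def Letter.IsPrimed {m : ℕ} (e : Letter m) : Prop := (ofLex e).2 = false

/-- `x_k` for the letter `k`, and `y_k` for the letter `k'`. -/
def Letter.weight {m : ℕ} (x y : Fin m → R) (e : Letter m) : R :=
  if (ofLex e).2 then x (ofLex e).1 else y (ofLex e).1

/-- Weakly increasing along rows and down columns, with no unprimed letter repeated in a column
and no primed letter repeated in a row. -/
structure IsTableau {n m : ℕ} {B : Finset ((_ : Fin n) × ℕ)} (T : B → Letter m) : Prop where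
  row_le : ∀ b c : B, b.1.1 = c.1.1 → b.1.2 < c.1.2 → T b ≤ T c
  col_le : ∀ b c : B, b.1.2 = c.1.2 → b.1.1 < c.1.1 → T b ≤ T c
  plain_col : ∀ b c : B, b.1.2 = c.1.2 → b.1.1 < c.1.1 → (T b).IsPlain → T b ≠ T c
  primed_row : ∀ b c : B, b.1.1 = c.1.1 → b.1.2 < c.1.2 → (T b).IsPrimed → T b ≠ T c

open Classical in
/-- The finite set of all tableaux on the shifted skew shape `l/u` with letters `1', 1, …, m', m`. -/
noncomputable def tableaux {n : ℕ} (l u : Fin n → ℕ) (m : ℕ) :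
    Finset (shiftedSkewShape l u → Letter m) :=
  Finset.univ.filter fun T => IsTableau T

end SchurPf

namespace SchurPf

variable {R : Type*} [CommRing R]

/-! Both sides obey the same recursion when the largest letter is removed. On tableaux, the boxes
with an unprimed letter form a horizontal strip and those with a primed letter a vertical strip, so
the tableau sum expands over the smaller strict shapes (`tableauxSum_plain`, `tableauxSum_primed`).
For the skew pseudo-pfaffian, the series acquires one factor $(1+yt)/(1-xt)$ at a time.

The algebraic expansion rests on linearity in each row (`skewPf_row_add`). If $e=f+xte$, a row with
$e$ becomes the same row with $f$ plus $x$ times the row with $e$ and its entry lowered by one.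
Unrolling this from the top row down stops when the entry meets the next one, where two neighbouring
rows agree and the value is zero; the surviving terms are the horizontal strips
(`skewPf_eq_sum_hStrips`). If $f=c+ytc$, each row keeps its entry or lowers it by one, and the
non-strict results vanish for the same reason, which leaves the vertical strips
(`skewPf_eq_sum_vStrips`).

Equal neighbouring rows give zero (`skewPf_eq_zero_of_adjacent_eq`) provided that
$\mathrm{Pf}_{p,p}(c,c)=0$ for $p>0$. This is where $y=x+z$ enters:
$(1+ys)(1+yt)-(1-xs)(1-xt)=(2x+z)(s+t+zst)$, and $s+t+zst$ is the denominator of the generating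
function of $\mathrm{Pf}_{p,q}$. Hence the new factor changes that function only by a term with zero
diagonal, and the diagonal stays that of the series $1$ (`pf₂_diag_eq`, `pf₂_partialSeries`). With
no letters left, both sides are $1$ or $0$ according to whether the two shapes agree (`skewPf_one`,
`tableauxSum_zero`). -/

/-! ### Coefficients of series and the two-row pseudo-pfaffian. -/

theorem chernCoeff_of_neg (c : R⟦X⟧) {k : ℤ} (hk : k < 0) : chernCoeff c k = 0 :=
  if_neg (not_le.mpr hk)

theorem chernCoeff_one (k : ℤ) : chernCoeff (1 : R⟦X⟧) k = if k = 0 then 1 else 0 := by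
  unfold chernCoeff
  rcases lt_trichotomy k 0 with h | rfl | h
  · simp [h.ne, not_le.mpr h]
  · simp
  · have h' : k.toNat ≠ 0 := by omega
    simp [h.le, h.ne', PowerSeries.coeff_one, h']

theorem chernCoeff_add_C_mul_X_mul (w : R) (b b' : R⟦X⟧) (k : ℤ) :
    chernCoeff (b + PowerSeries.C w * PowerSeries.X * b') k =
      chernCoeff b k + w * chernCoeff b' (k - 1) := by
  unfold chernCoeff
  rcases lt_trichotomy k 0 with h | rfl | h
  · rw [if_neg (by omega), if_neg (by omega), if_neg (by omega)]; simp
  · simp [mul_assoc]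
  · rw [if_pos (by omega), if_pos (by omega), if_pos (by omega)]
    obtain ⟨j, rfl⟩ : ∃ j : ℕ, k = j + 1 := ⟨(k - 1).toNat, by omega⟩
    have h1 : ((j : ℤ) + 1).toNat = j + 1 := by omega
    have h2 : ((j : ℤ) + 1 - 1).toNat = j := by omega
    rw [h1, h2, mul_assoc]
    simp [PowerSeries.coeff_succ_X_mul]

/-- The coefficient `∑_i (binom(j,i) + binom(j-1,i)) z^i a_{p+j-i}` of `(-1)^j b_{q-j}` in
`Pf_{p,q}(a, b)`. -/
noncomputable def binomShift (z : R) (a : R⟦X⟧) (j : ℕ) (p : ℤ) : R :=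
  ∑ i ∈ Finset.range (j + 1), (binomSum j i : R) * z ^ i * chernCoeff a (p + (j : ℤ) - (i : ℤ))

theorem binomShift_zero (z : R) (a : R⟦X⟧) (p : ℤ) : binomShift z a 0 p = chernCoeff a p := by
  simp [binomShift, binomSum]

theorem binomShift_add (z w : R) (b b' : R⟦X⟧) (j : ℕ) (p : ℤ) :
    binomShift z (b + PowerSeries.C w * PowerSeries.X * b') j p =
      binomShift z b j p + w * binomShift z b' j (p - 1) := by
  simp only [binomShift, chernCoeff_add_C_mul_X_mul, Finset.mul_sum, ← Finset.sum_add_distrib]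
  refine Finset.sum_congr rfl fun i _ => ?_
  rw [show p + (j : ℤ) - i - 1 = p - 1 + j - i by ring]
  ring

theorem binomSum_eq_zero {j i : ℕ} (h : j < i) : binomSum j i = 0 := by
  unfold binomSum
  rw [Nat.choose_eq_zero_of_lt h]
  split_ifs
  · simp
  · rw [Nat.choose_eq_zero_of_lt (by omega)]; simp

theorem binomSum_succ_succ {j : ℕ} (hj : j ≠ 0) (i : ℕ) :
    binomSum (j + 1) (i + 1) = binomSum j i + binomSum j (i + 1) := by
  obtain ⟨k, rfl⟩ := Nat.exists_eq_succ_of_ne_zero hj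
  simp only [binomSum, Nat.succ_eq_add_one, Nat.add_eq_zero_iff, one_ne_zero, and_false, if_false,
    Nat.add_sub_cancel, Nat.choose_succ_succ (k + 1) i, Nat.choose_succ_succ k i]
  push_cast
  ring

/-- Pascal's rule: with $S$ the shift of the index, `binomShift` is $(1+zS)^j+(1+zS)^{j-1}$ for
$j>0$, but only $1$ for $j=0$; the last summand corrects for this exception. -/
theorem binomShift_succ (z : R) (a : R⟦X⟧) (j : ℕ) (p : ℤ) :
    binomShift z a (j + 1) p = binomShift z a j (p + 1) + z * binomShift z a j p +
      if j = 0 then chernCoeff a (p + 1) else 0 := by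
  split_ifs with hj
  · subst hj
    simp [binomShift, binomSum, Finset.sum_range_succ]
    ring
  · unfold binomShift
    rw [Finset.sum_range_succ' _ (j + 1), add_zero, Finset.sum_range_succ'
      (fun i => (binomSum j i : R) * z ^ i * chernCoeff a (p + 1 + (j : ℤ) - (i : ℤ))) j]
    have h1 : ∀ i ∈ Finset.range (j + 1), (binomSum (j + 1) (i + 1) : R) * z ^ (i + 1) *
        chernCoeff a (p + ((j + 1 : ℕ) : ℤ) - ((i + 1 : ℕ) : ℤ)) =
        z * ((binomSum j i : R) * z ^ i * chernCoeff a (p + (j : ℤ) - (i : ℤ))) +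
        (binomSum j (i + 1) : R) * z ^ (i + 1) *
          chernCoeff a (p + 1 + (j : ℤ) - ((i + 1 : ℕ) : ℤ)) := by
      intro i _
      rw [binomSum_succ_succ hj]
      have e1 : p + ((j + 1 : ℕ) : ℤ) - ((i + 1 : ℕ) : ℤ) = p + (j : ℤ) - (i : ℤ) := by
        push_cast; ring
      have e2 : p + 1 + (j : ℤ) - ((i + 1 : ℕ) : ℤ) = p + (j : ℤ) - (i : ℤ) := by
        push_cast; ring
      rw [e1, e2]; push_cast; ring
    rw [Finset.sum_congr rfl h1, Finset.sum_add_distrib, ← Finset.mul_sum,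
      Finset.sum_range_succ (fun i => (binomSum j (i + 1) : R) * z ^ (i + 1) *
          chernCoeff a (p + 1 + (j : ℤ) - ((i + 1 : ℕ) : ℤ))), binomSum_eq_zero (Nat.lt_succ_self j)]
    have h0 : binomSum (j + 1) 0 = binomSum j 0 := by simp [binomSum, hj]
    rw [h0, show p + ((j + 1 : ℕ) : ℤ) - ((0 : ℕ) : ℤ) = p + 1 + (j : ℤ) - ((0 : ℕ) : ℤ) by
      push_cast; ring]
    push_cast
    ring

theorem pf₂_eq_sum (z : R) (p q : ℤ) (a b : R⟦X⟧) {M : ℕ} (hM : q < M) :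
    pf₂ z p q a b =
      ∑ j ∈ Finset.range M, (-1) ^ j * binomShift z a j p * chernCoeff b (q - j) := by
  unfold pf₂
  split_ifs with hq
  · rw [← Finset.sum_subset (Finset.range_mono (show q.toNat + 1 ≤ M by omega))]
    · refine Finset.sum_congr rfl fun j _ => ?_
      rw [binomShift, Finset.mul_sum, Finset.sum_mul]
      exact Finset.sum_congr rfl fun i _ => by ring
    · intro j _ hj
      rw [chernCoeff_of_neg _ (by simp at hj; omega), mul_zero]
  · exact (Finset.sum_eq_zero fun j _ => by
      rw [chernCoeff_of_neg _ (by omega), mul_zero]).symm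

theorem pf₂_of_neg (z : R) (p : ℤ) {q : ℤ} (a b : R⟦X⟧) (hq : q < 0) : pf₂ z p q a b = 0 :=
  if_neg (not_le.mpr hq)

theorem pf₂_zero_right (z : R) (p : ℤ) (a b : R⟦X⟧) :
    pf₂ z p 0 a b = chernCoeff a p * chernCoeff b 0 := by
  simp [pf₂_eq_sum z p 0 a b (M := 1) (by norm_num), binomShift_zero]

theorem pf₂_of_add_neg (z : R) {p q : ℤ} (a b : R⟦X⟧) (h : p + q < 0) : pf₂ z p q a b = 0 := by
  rw [pf₂_eq_sum z p q a b (M := (q + 1).toNat) (by omega)]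
  refine Finset.sum_eq_zero fun j hj => ?_
  have hj' : (j : ℤ) ≤ q := by have := Finset.mem_range.mp hj; omega
  rw [binomShift, Finset.sum_eq_zero fun i _ => ?_, mul_zero, zero_mul]
  rw [chernCoeff_of_neg _ (by omega), mul_zero]

theorem pf₂_one (z : R) {p : ℤ} (hp : 0 < p) (q : ℤ) : pf₂ z p q 1 1 = 0 := by
  rw [pf₂_eq_sum z p q 1 1 (M := (q + 1).toNat) (by omega)]
  refine Finset.sum_eq_zero fun j hj => ?_
  rw [binomShift, Finset.sum_eq_zero fun i hi => ?_, mul_zero, zero_mul]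
  rw [chernCoeff_one, if_neg, mul_zero]
  have := Finset.mem_range.mp hi
  omega

theorem pf₂_add_left (z w : R) (p q : ℤ) (b b' d : R⟦X⟧) :
    pf₂ z p q (b + PowerSeries.C w * PowerSeries.X * b') d =
      pf₂ z p q b d + w * pf₂ z (p - 1) q b' d := by
  have hM : q < ((q + 1).toNat : ℕ) := by omega
  simp only [pf₂_eq_sum _ _ _ _ _ hM, binomShift_add, Finset.mul_sum, ← Finset.sum_add_distrib]
  exact Finset.sum_congr rfl fun j _ => by ring

theorem pf₂_add_right (z w : R) (p q : ℤ) (b b' d : R⟦X⟧) :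
    pf₂ z p q d (b + PowerSeries.C w * PowerSeries.X * b') =
      pf₂ z p q d b + w * pf₂ z p (q - 1) d b' := by
  have hM : q < ((q + 1).toNat : ℕ) := by omega
  have hM' : q - 1 < ((q + 1).toNat : ℕ) := by omega
  simp only [pf₂_eq_sum _ _ _ _ _ hM, pf₂_eq_sum _ _ _ _ _ hM', chernCoeff_add_C_mul_X_mul,
    Finset.mul_sum, ← Finset.sum_add_distrib]
  exact Finset.sum_congr rfl fun j _ => by
    rw [show q - (j : ℤ) - 1 = q - 1 - j by ring]; ring

/-- The generating function of the `Pf_{p,q}(a,b)` is `a(s) b(t) (s - t) / (s + t + z s t)`. -/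
theorem pf₂_recursion (z : R) (p q : ℤ) (a b : R⟦X⟧) :
    pf₂ z (p - 1) q a b + pf₂ z p (q - 1) a b + z * pf₂ z (p - 1) (q - 1) a b =
      chernCoeff a (p - 1) * chernCoeff b q - chernCoeff a p * chernCoeff b (q - 1) := by
  rcases lt_or_ge q 0 with hq | hq
  · rw [pf₂_of_neg _ _ _ _ hq, pf₂_of_neg _ _ _ _ (by omega), pf₂_of_neg _ _ _ _ (by omega),
      chernCoeff_of_neg b hq, chernCoeff_of_neg b (by omega)]
    ring
  · rw [pf₂_eq_sum z (p - 1) q a b (M := q.toNat + 1 + 1) (by omega), Finset.sum_range_succ',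
      pf₂_eq_sum z _ (q - 1) a b (M := q.toNat + 1) (by omega),
      pf₂_eq_sum z _ (q - 1) a b (M := q.toNat + 1) (by omega)]
    have h1 : ∀ j ∈ Finset.range (q.toNat + 1),
        (-1) ^ (j + 1) * binomShift z a (j + 1) (p - 1) * chernCoeff b (q - ((j + 1 : ℕ) : ℤ)) =
        -((-1) ^ j * binomShift z a j p * chernCoeff b (q - 1 - j)) -
        z * ((-1) ^ j * binomShift z a j (p - 1) * chernCoeff b (q - 1 - j)) -
        (if j = 0 then chernCoeff a p * chernCoeff b (q - 1) else 0) := by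
      intro j _
      rw [binomShift_succ, show q - ((j + 1 : ℕ) : ℤ) = q - 1 - j by push_cast; ring,
        sub_add_cancel]
      split_ifs with hj
      · subst hj; simp; ring
      · ring
    rw [Finset.sum_congr rfl h1, Finset.sum_sub_distrib, Finset.sum_sub_distrib,
      Finset.sum_neg_distrib, ← Finset.mul_sum, Finset.sum_ite_eq' (Finset.range (q.toNat + 1)) 0,
      if_pos (by simp), binomShift_zero]
    simp
    ring

/-! ### Invariance of the diagonal values under a factor $(1+(x+z)t)/(1-xt)$. -/

section Diagonal

variable (z x : R) (e c : R⟦X⟧)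

theorem pf₂_expand_both (w : R) (p q : ℤ) :
    pf₂ z p q (c + PowerSeries.C w * PowerSeries.X * c) (c + PowerSeries.C w * PowerSeries.X * c) =
      pf₂ z p q c c + w * (pf₂ z (p - 1) q c c + pf₂ z p (q - 1) c c) +
        w ^ 2 * pf₂ z (p - 1) (q - 1) c c := by
  simp only [pf₂_add_left, pf₂_add_right]
  ring

variable {z x e c}

/-- By `pf₂_recursion`, passing from $(1-xs)(1-xt)$ to $(1+ys)(1+yt)$ adds $(2x+z)(s-t)c(s)c(t)$ to
the generating function of $c$. This is antisymmetric, so it disappears after symmetrization; the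
factor $(1-xs)(1-xt)$ is then cancelled by induction on $p+q$. -/
theorem pf₂_symm_eq (h : e + PowerSeries.C (-x) * PowerSeries.X * e =
    c + PowerSeries.C (x + z) * PowerSeries.X * c) (N : ℕ) (p q : ℤ) (hN : p + q < N) :
    pf₂ z p q e e + pf₂ z q p e e = pf₂ z p q c c + pf₂ z q p c c := by
  induction N generalizing p q with
  | zero =>
    simp [pf₂_of_add_neg z _ _ (show p + q < 0 by simpa using hN),
      pf₂_of_add_neg z _ _ (show q + p < 0 by rw [add_comm]; simpa using hN)]
  | succ N ih =>
    push_cast at hN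
    have h1 := ih (p - 1) q (by omega)
    have h2 := ih p (q - 1) (by omega)
    have h3 := ih (p - 1) (q - 1) (by omega)
    have e1 := pf₂_expand_both z e (-x) p q
    have e2 := pf₂_expand_both z e (-x) q p
    rw [h, pf₂_expand_both] at e1 e2
    have r1 := pf₂_recursion z p q c c
    have r2 := pf₂_recursion z q p c c
    linear_combination x * h1 + x * h2 - x ^ 2 * h3 - e1 - e2 + (2 * x + z) * (r1 + r2)

/-- Setting $p=q$ in `pf₂_symm_eq` gives only twice the claim, and $2$ may be a zero divisor. The
diagonal therefore has its own induction, with `pf₂_symm_eq` supplying the off-diagonal neighbours.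
-/
theorem pf₂_diag_eq (h : e + PowerSeries.C (-x) * PowerSeries.X * e =
    c + PowerSeries.C (x + z) * PowerSeries.X * c) (N : ℕ) (p : ℤ) (hN : p < N) :
    pf₂ z p p e e = pf₂ z p p c c := by
  induction N generalizing p with
  | zero =>
    have : p < 0 := by simpa using hN
    rw [pf₂_of_neg _ _ _ _ this, pf₂_of_neg _ _ _ _ this]
  | succ N ih =>
    push_cast at hN
    have h1 := pf₂_symm_eq h (2 * p).toNat p (p - 1) (by omega)
    have h3 := ih (p - 1) (by omega)
    have e1 := pf₂_expand_both z e (-x) p p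
    rw [h, pf₂_expand_both] at e1
    have r1 := pf₂_recursion z p p c c
    linear_combination x * h1 - x ^ 2 * h3 - e1 + (2 * x + z) * r1

end Diagonal

/-! ### Pseudo-pfaffians: linearity in a row and vanishing for equal neighbours. -/

theorem sum_alternating_eq_zero {N : ℕ} {s s' : Fin N} (hs : (s' : ℕ) = s + 1) (f : Fin N → R)
    (hf : f s = f s') (h0 : ∀ k, k ≠ s → k ≠ s' → f k = 0) :
    ∑ k : Fin N, (-1) ^ (k : ℕ) * f k = 0 := by
  have hne : s ≠ s' := fun h => by rw [h] at hs; omega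
  rw [Fintype.sum_eq_add s s' hne fun k hk => by rw [h0 k hk.1 hk.2, mul_zero], hs, hf]
  ring

theorem exists_succAbove_adjacent {N : ℕ} {s s' k : Fin (N + 1)} (hs : (s' : ℕ) = s + 1)
    (h : k ≠ s) (h' : k ≠ s') :
    ∃ t t' : Fin N, (t' : ℕ) = t + 1 ∧ k.succAbove t = s ∧ k.succAbove t' = s' := by
  obtain ⟨t, ht⟩ := Fin.exists_succAbove_eq h.symm
  obtain ⟨t', ht'⟩ := Fin.exists_succAbove_eq h'.symm
  refine ⟨t, t', ?_, ht, ht'⟩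
  rw [← ht, ← ht'] at hs
  simp only [Fin.succAbove, Fin.lt_def] at hs ht ht'
  have h1 : (k : ℕ) ≠ s := fun e => h (Fin.ext e)
  have h2 : (k : ℕ) ≠ s' := fun e => h' (Fin.ext e)
  split_ifs at hs ht ht' <;> subst ht <;> subst ht' <;> simp_all <;> omega

theorem comp_succAbove_adjacent {α : Type*} {N : ℕ} {s s' : Fin (N + 1)} (hs : (s' : ℕ) = s + 1)
    (f : Fin (N + 1) → α) (hf : f s = f s') (i : Fin N) :
    f (s.succAbove i) = f (s'.succAbove i) := by
  -- The two deletions differ only at position `s`, where one keeps `s'` and the other keeps `s`.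
  by_cases h : (i : ℕ) = s
  · have h1 : s.succAbove i = s' := by
      rw [Fin.succAbove_of_le_castSucc _ _ (by rw [Fin.le_def]; simp [h])]
      ext; simp [hs, h]
    have h2 : s'.succAbove i = s := by
      rw [Fin.succAbove_of_castSucc_lt _ _ (by rw [Fin.lt_def]; simp [hs, h])]
      ext; simp [h]
    rw [h1, h2, hf]
  · congr 1
    ext
    simp only [Fin.succAbove, Fin.lt_def]
    split_ifs <;> simp_all <;> omega

/-- Deleting the same two indices in the opposite order leaves the same complement and the same
product of values of `g`, but reverses the sign. -/
theorem sum_sum_succAbove_eq_zero {N : ℕ} (g : Fin (N + 2) → R)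
    (Φ : (Fin N → Fin (N + 2)) → R) :
    ∑ k : Fin (N + 2), ∑ j : Fin (N + 1), (-1) ^ ((k : ℕ) + j) * (g k * g (k.succAbove j)) *
      Φ (fun i => k.succAbove (j.succAbove i)) = 0 := by
  rw [← Fintype.sum_prod_type' (f := fun (k : Fin (N + 2)) (j : Fin (N + 1)) =>
    (-1) ^ ((k : ℕ) + j) * (g k * g (k.succAbove j)) *
      Φ (fun i => k.succAbove (j.succAbove i)))]
  refine Finset.sum_involution (fun p _ => (p.1.succAbove p.2, p.2.predAbove p.1)) ?_ ?_ ?_ ?_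
  · rintro ⟨k, j⟩ _
    simp only [Fin.neg_one_pow_succAbove_add_predAbove, Fin.succAbove_succAbove_predAbove,
      Fin.succAbove_succAbove_succAbove_predAbove]
    ring
  · rintro ⟨k, j⟩ _ _ h
    exact Fin.succAbove_ne _ _ (congrArg Prod.fst h)
  · intros; exact Finset.mem_univ _
  · rintro ⟨k, j⟩ _
    simp only [Fin.succAbove_succAbove_predAbove, Fin.predAbove_predAbove_succAbove]

theorem pf_even (z : R) {n : ℕ} (hn : Even n) (l : Fin (n + 2) → ℤ) (c : Fin (n + 2) → R⟦X⟧) :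
    pf z (n + 2) l c =
      ∑ k : Fin (n + 1), (-1) ^ (k : ℕ) * (pf₂ z (l 0) (l k.succ) (c 0) (c k.succ) *
        pf z n (fun i => l (k.succAbove i).succ) (fun i => c (k.succAbove i).succ)) := by
  rw [pf, if_pos hn]
  exact Finset.sum_congr rfl fun k _ => by ring

theorem pf_odd (z : R) {n : ℕ} (hn : ¬Even n) (l : Fin (n + 2) → ℤ) (c : Fin (n + 2) → R⟦X⟧) :
    pf z (n + 2) l c =
      ∑ k : Fin (n + 2), (-1) ^ (k : ℕ) * (chernCoeff (c k) (l k) *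
        pf z (n + 1) (fun i => l (k.succAbove i)) (fun i => c (k.succAbove i))) := by
  rw [pf, if_neg hn]
  exact Finset.sum_congr rfl fun k _ => by ring

/-- `Pf_l(a)` with the row `a_r = b_r + w t b'_r` is `Pf_l(b) + w Pf_{l'}(b')`, where `l'` arises
from `l` by lowering the entry `r` by one. -/
theorem pf_row_add (z w : R) : (n : ℕ) → (l l' : Fin n → ℤ) → (a b b' : Fin n → R⟦X⟧) →
    (r : Fin n) → a r = b r + PowerSeries.C w * PowerSeries.X * b' r → l' r = l r - 1 →
    (∀ j ≠ r, a j = b j ∧ a j = b' j ∧ l' j = l j) →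
    pf z n l a = pf z n l b + w * pf z n l' b'
  | 0, _, _, _, _, _, r, _, _, _ => r.elim0
  | 1, l, l', a, b, b', r, ha, hl, _ => by
    obtain rfl : r = 0 := Subsingleton.elim _ _
    simp only [pf, ha, hl, chernCoeff_add_C_mul_X_mul]
  | n + 2, l, l', a, b, b', r, ha, hl, hj => by
    -- In either expansion, row `r` enters each product through exactly one factor: the coefficient
    -- or `pf₂` in front, or the remaining minor.
    by_cases hn : Even n
    · rw [pf_even z hn, pf_even z hn, pf_even z hn, Finset.mul_sum, ← Finset.sum_add_distrib]
      refine Finset.sum_congr rfl fun k _ => ?_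
      rcases Fin.eq_zero_or_eq_succ r with rfl | ⟨r', rfl⟩
      · have h1 : ∀ i : Fin (n + 1), a i.succ = b i.succ := fun i => (hj _ (Fin.succ_ne_zero i)).1
        have h2 : ∀ i : Fin (n + 1), b' i.succ = b i.succ := fun i =>
          (hj _ (Fin.succ_ne_zero i)).2.1.symm.trans (h1 i)
        have h3 : ∀ i : Fin (n + 1), l' i.succ = l i.succ := fun i => (hj _ (Fin.succ_ne_zero i)).2.2
        simp only [h1, h2, h3, ha, hl, pf₂_add_left]
        ring
      · obtain ⟨z1, z2, z3⟩ := hj 0 (Fin.succ_ne_zero r').symm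
        rw [← z1, ← z2, z3]
        by_cases hk : k = r'
        · subst hk
          have h0 : ∀ i : Fin n, (k.succAbove i).succ ≠ k.succ := fun i h =>
            Fin.succAbove_ne k i (Fin.succ_injective _ h)
          have h1 : ∀ i : Fin n, a (k.succAbove i).succ = b (k.succAbove i).succ :=
            fun i => (hj _ (h0 i)).1
          have h2 : ∀ i : Fin n, b' (k.succAbove i).succ = b (k.succAbove i).succ := fun i =>
            (hj _ (h0 i)).2.1.symm.trans (h1 i)
          have h3 : ∀ i : Fin n, l' (k.succAbove i).succ = l (k.succAbove i).succ :=
            fun i => (hj _ (h0 i)).2.2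
          simp only [h1, h2, h3, ha, hl, pf₂_add_right]
          ring
        · obtain ⟨t, ht⟩ := Fin.exists_succAbove_eq (Ne.symm hk)
          obtain ⟨y1, y2, y3⟩ := hj k.succ (fun h => hk (Fin.succ_injective _ h))
          rw [← y1, ← y2, y3, pf_row_add z w n (fun i => l (k.succAbove i).succ)
            (fun i => l' (k.succAbove i).succ) (fun i => a (k.succAbove i).succ)
            (fun i => b (k.succAbove i).succ) (fun i => b' (k.succAbove i).succ) t
            (by simpa only [ht] using ha) (by simpa only [ht] using hl)]
          · ring
          · intro j hjt
            refine hj _ fun h => hjt ?_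
            rw [← ht] at h
            exact Fin.succAbove_right_injective (Fin.succ_injective _ h)
    · rw [pf_odd z hn, pf_odd z hn, pf_odd z hn, Finset.mul_sum, ← Finset.sum_add_distrib]
      refine Finset.sum_congr rfl fun k _ => ?_
      by_cases hk : k = r
      · subst hk
        have h0 : ∀ i : Fin (n + 1), k.succAbove i ≠ k := fun i => Fin.succAbove_ne k i
        have h1 : ∀ i : Fin (n + 1), a (k.succAbove i) = b (k.succAbove i) :=
          fun i => (hj _ (h0 i)).1
        have h2 : ∀ i : Fin (n + 1), b' (k.succAbove i) = b (k.succAbove i) := fun i =>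
          (hj _ (h0 i)).2.1.symm.trans (h1 i)
        have h3 : ∀ i : Fin (n + 1), l' (k.succAbove i) = l (k.succAbove i) :=
          fun i => (hj _ (h0 i)).2.2
        simp only [h1, h2, h3, ha, hl, chernCoeff_add_C_mul_X_mul]
        ring
      · obtain ⟨t, ht⟩ := Fin.exists_succAbove_eq (Ne.symm hk)
        obtain ⟨y1, y2, y3⟩ := hj k hk
        rw [← y1, ← y2, y3, pf_row_add z w (n + 1) (fun i => l (k.succAbove i))
          (fun i => l' (k.succAbove i)) (fun i => a (k.succAbove i))
          (fun i => b (k.succAbove i)) (fun i => b' (k.succAbove i)) t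
          (by simpa only [ht] using ha) (by simpa only [ht] using hl)]
        · ring
        · intro j hjt
          refine hj _ fun h => hjt ?_
          rw [← ht] at h
          exact Fin.succAbove_right_injective h

/-- The pseudo-pfaffian with its first two rows equal vanishes. -/
theorem pf_eq_zero_of_first_eq (z : R) {n : ℕ} (hn : Even n) (l : Fin (n + 2) → ℤ)
    (c : Fin (n + 2) → R⟦X⟧) (hl : l 0 = l 1) (hc : c 0 = c 1)
    (h0 : pf₂ z (l 0) (l 0) (c 0) (c 0) = 0) : pf z (n + 2) l c = 0 := by
  rw [pf_even z hn]
  rcases n with _ | _ | n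
  · have h1 : (Fin.succ 0 : Fin 2) = 1 := rfl
    simp [h1, ← hl, ← hc, h0]
  · exact absurd hn (by decide)
  · have hn' : Even n := by
      simpa [Nat.even_add_one] using hn
    -- The term pairing the two equal rows is zero by `h0`. In the others, the minor is expanded
    -- along row 1, a copy of row 0, so the two `pf₂` factors play symmetric roles and the double
    -- sum cancels.
    rw [Fin.sum_univ_succ]
    have h1 : (Fin.succ 0 : Fin (n + 4)) = 1 := rfl
    rw [h1, ← hl, ← hc, h0, zero_mul, mul_zero, zero_add,
      ← sum_sum_succAbove_eq_zero (fun k : Fin (n + 2) =>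
        pf₂ z (l 0) (l k.succ.succ) (c 0) (c k.succ.succ))
        (fun e => - pf z n (fun i => l (e i).succ.succ) (fun i => c (e i).succ.succ))]
    refine Finset.sum_congr rfl fun k _ => ?_
    rw [pf_even z hn', Finset.mul_sum, Finset.mul_sum]
    refine Finset.sum_congr rfl fun j _ => ?_
    have h2 : ((k.succ.succAbove 0).succ : Fin (n + 4)) = 1 := by simp
    simp only [h2, Fin.succ_succAbove_succ, ← hl, ← hc, Fin.val_succ]
    ring

/-- The pseudo-pfaffian with two equal neighbouring rows vanishes. -/
theorem pf_eq_zero_of_adjacent_eq (z : R) : (n : ℕ) → (l : Fin n → ℤ) → (c : Fin n → R⟦X⟧) →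
    (s s' : Fin n) → (s' : ℕ) = s + 1 → l s = l s' → c s = c s' →
    pf₂ z (l s) (l s) (c s) (c s) = 0 → pf z n l c = 0
  | 0, _, _, s, _, _, _, _, _ => s.elim0
  | 1, _, _, s, s', h, _, _, _ => by omega
  | n + 2, l, c, s, s', h, hl, hc, h0 => by
    by_cases hn : Even n
    · rcases Fin.eq_zero_or_eq_succ s with rfl | ⟨t, rfl⟩
      · obtain rfl : s' = 1 := Fin.ext (by simpa using h)
        exact pf_eq_zero_of_first_eq z hn l c hl hc h0
      · obtain ⟨t', rfl⟩ : ∃ t', s' = Fin.succ t' :=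
          (Fin.eq_zero_or_eq_succ s').resolve_left fun e => by simp [e] at h
        have ht : (t' : ℕ) = t + 1 := by simpa using h
        rw [pf_even z hn]
        -- The terms for the two equal rows cancel; every other minor still contains both as
        -- neighbours.
        refine sum_alternating_eq_zero ht _ ?_ ?_
        · rw [hl, hc]
          congr 2
          · exact funext (comp_succAbove_adjacent ht (fun i => l i.succ) hl)
          · exact funext (comp_succAbove_adjacent ht (fun i => c i.succ) hc)
        · intro k hk hk'
          obtain ⟨u, u', hu, e, e'⟩ := exists_succAbove_adjacent ht hk hk'
          rw [pf_eq_zero_of_adjacent_eq z n _ _ u u' hu, mul_zero]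
          · simpa only [e, e'] using hl
          · simpa only [e, e'] using hc
          · simpa only [e, e'] using h0
    · rw [pf_odd z hn]
      refine sum_alternating_eq_zero h _ ?_ ?_
      · rw [hl, hc]
        congr 2
        · exact funext (comp_succAbove_adjacent h l hl)
        · exact funext (comp_succAbove_adjacent h c hc)
      · intro k hk hk'
        obtain ⟨u, u', hu, e, e'⟩ := exists_succAbove_adjacent h hk hk'
        rw [pf_eq_zero_of_adjacent_eq z (n + 1) _ _ u u' hu, mul_zero]
        · simpa only [e, e'] using hl
        · simpa only [e, e'] using hc
        · simpa only [e, e'] using h0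

/-! ### Negative entries, and the values at the series $1$. -/

/-- The condition on the later entries is essential: $\mathrm{Pf}_{p,q}$ with $p<0$ can be nonzero
when $q>0$, but is zero when $q\le0$. -/
theorem pf_eq_zero_of_neg (z : R) : (n : ℕ) → (l : Fin n → ℤ) → (c : Fin n → R⟦X⟧) →
    (r : Fin n) → l r < 0 → (∀ j, r < j → l j ≤ 0) → pf z n l c = 0
  | 0, _, _, r, _, _ => r.elim0
  | 1, l, c, r, hr, _ => by
    obtain rfl : r = 0 := Subsingleton.elim _ _
    exact chernCoeff_of_neg _ hr
  | n + 2, l, c, r, hr, hj => by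
    by_cases hn : Even n
    · rw [pf_even z hn]
      refine Finset.sum_eq_zero fun k _ => ?_
      rcases Fin.eq_zero_or_eq_succ r with rfl | ⟨r', rfl⟩
      · rcases (hj k.succ (Fin.succ_pos k)).lt_or_eq with h | h
        · rw [pf₂_of_neg _ _ _ _ h, zero_mul, mul_zero]
        · rw [h, pf₂_zero_right, chernCoeff_of_neg _ hr, zero_mul, zero_mul, mul_zero]
      · by_cases hk : k = r'
        · rw [hk, pf₂_of_neg _ _ _ _ hr, zero_mul, mul_zero]
        · obtain ⟨t, ht⟩ := Fin.exists_succAbove_eq (Ne.symm hk)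
          rw [pf_eq_zero_of_neg z n _ _ t (by simpa only [ht] using hr), mul_zero, mul_zero]
          intro j htj
          refine hj _ (Fin.succ_lt_succ_iff.mpr ?_)
          rw [← ht]
          exact Fin.strictMono_succAbove k htj
    · rw [pf_odd z hn]
      refine Finset.sum_eq_zero fun k _ => ?_
      by_cases hk : k = r
      · rw [hk, chernCoeff_of_neg _ hr, zero_mul, mul_zero]
      · obtain ⟨t, ht⟩ := Fin.exists_succAbove_eq (Ne.symm hk)
        rw [pf_eq_zero_of_neg z (n + 1) _ _ t (by simpa only [ht] using hr), mul_zero, mul_zero]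
        intro j htj
        refine hj _ ?_
        rw [← ht]
        exact Fin.strictMono_succAbove k htj

theorem pf_one_even_of_pos (z : R) {n : ℕ} (hn : Even n) (l : Fin (n + 2) → ℤ) (h : 0 < l 0) :
    pf z (n + 2) l (fun _ => 1) = 0 := by
  rw [pf_even z hn]
  exact Finset.sum_eq_zero fun k _ => by rw [pf₂_one z h, zero_mul, mul_zero]

/-- For an odd number of rows, the term that splits off row 0 has a zero coefficient, and every
other minor is an even one with the same first row. -/
theorem pf_one_of_pos (z : R) {n : ℕ} (l : Fin (n + 1) → ℤ) (h : 0 < l 0) :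
    pf z (n + 1) l (fun _ => 1) = 0 := by
  rcases n with _ | n
  · exact (chernCoeff_one _).trans (if_neg h.ne')
  · by_cases hn : Even n
    · exact pf_one_even_of_pos z hn l h
    · rw [pf_odd z hn]
      refine Finset.sum_eq_zero fun k _ => ?_
      rcases Fin.eq_zero_or_eq_succ k with rfl | ⟨k, rfl⟩
      · rw [chernCoeff_one, if_neg h.ne', zero_mul, mul_zero]
      · rcases n with _ | n
        · exact absurd (by decide) hn
        · have hn' : Even n := by
            rw [Nat.even_add_one] at hn; exact not_not.mp hn
          rw [pf_one_even_of_pos z hn' _ (by simpa using h), mul_zero, mul_zero]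

theorem sum_neg_one_pow_fin (n : ℕ) (hn : Even n) : ∑ k : Fin (n + 1), (-1 : R) ^ (k : ℕ) = 1 := by
  rw [Fin.sum_univ_eq_sum_range (fun k => (-1 : R) ^ k), neg_one_geom_sum, if_neg]
  rw [Nat.even_add_one]; exact not_not.mpr hn

/-- Every factor is $1$, and for either parity the expansion has an odd number of alternating signs.
-/
theorem pf_one_zero (z : R) : (n : ℕ) → pf z n (fun _ => 0) (fun _ => 1) = 1
  | 0 => rfl
  | 1 => by simp [pf, chernCoeff_one]
  | n + 2 => by
    by_cases hn : Even n
    · rw [pf_even z hn]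
      simp only [pf₂_zero_right, chernCoeff_one, pf_one_zero z n, if_true, mul_one]
      exact sum_neg_one_pow_fin n hn
    · rw [pf_odd z hn]
      simp only [chernCoeff_one, pf_one_zero z (n + 1), if_true, mul_one]
      exact sum_neg_one_pow_fin (n + 1) (by rw [Nat.even_add_one]; exact hn)

/-! ### Blocks and skew pseudo-pfaffians. -/

/-- Any increasing enumeration of a block may replace the canonical one, which avoids rewriting
along equalities of cardinalities. -/
theorem blockPf_eq_of_strictMono (z : R) {n N : ℕ} (l : Fin n → ℤ) (c : Fin n → R⟦X⟧)
    (v : Fin n → ℕ) (k : ℕ) (f : Fin N → Fin n) (hf : StrictMono f)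
    (hr : ∀ i, v i = k ↔ ∃ s, f s = i) :
    blockPf z l c v k = pf z N (fun s => l (f s) - (k : ℤ)) (fun s => c (f s)) := by
  have hI : (Finset.univ.filter fun i => v i = k) = Finset.univ.image f := by
    ext i; simp [hr]
  have hN : (Finset.univ.filter fun i => v i = k).card = N := by
    rw [hI, Finset.card_image_of_injective _ hf.injective, Finset.card_fin]
  subst hN
  have h := Finset.orderEmbOfFin_unique (s := Finset.univ.filter fun i => v i = k) rfl (f := f)
    (fun s => by simpa using (hr _).mpr ⟨s, rfl⟩) hf
  unfold blockPf
  simp only [h]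

theorem exists_block {n : ℕ} (v : Fin n → ℕ) (k : ℕ) :
    ∃ (N : ℕ) (f : Fin N → Fin n), StrictMono f ∧ ∀ i, v i = k ↔ ∃ s, f s = i := by
  refine ⟨_, (Finset.univ.filter fun i => v i = k).orderEmbOfFin rfl,
    OrderEmbedding.strictMono _, fun i => ?_⟩
  have := Finset.range_orderEmbOfFin (Finset.univ.filter fun i => v i = k) rfl
  rw [← Set.mem_range, this]
  simp

theorem blockPf_congr (z : R) {n : ℕ} (l l' : Fin n → ℤ) (c c' : Fin n → R⟦X⟧)
    (v : Fin n → ℕ) (k : ℕ) (h : ∀ i, v i = k → l i = l' i ∧ c i = c' i) :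
    blockPf z l c v k = blockPf z l' c' v k := by
  obtain ⟨N, f, hf, hr⟩ := exists_block v k
  rw [blockPf_eq_of_strictMono z l c v k f hf hr, blockPf_eq_of_strictMono z l' c' v k f hf hr]
  have h1 : ∀ s, l (f s) = l' (f s) := fun s => (h _ ((hr _).mpr ⟨s, rfl⟩)).1
  have h2 : ∀ s, c (f s) = c' (f s) := fun s => (h _ ((hr _).mpr ⟨s, rfl⟩)).2
  simp only [h1, h2]

theorem blockPf_row_add (z w : R) {n : ℕ} (l l' : Fin n → ℤ) (a b b' : Fin n → R⟦X⟧)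
    (v : Fin n → ℕ) (r : Fin n) (ha : a r = b r + PowerSeries.C w * PowerSeries.X * b' r)
    (hl : l' r = l r - 1) (hj : ∀ j ≠ r, a j = b j ∧ a j = b' j ∧ l' j = l j) :
    blockPf z l a v (v r) = blockPf z l b v (v r) + w * blockPf z l' b' v (v r) := by
  obtain ⟨N, f, hf, hr⟩ := exists_block v (v r)
  obtain ⟨t, ht⟩ := (hr r).mp rfl
  rw [blockPf_eq_of_strictMono z l a v _ f hf hr, blockPf_eq_of_strictMono z l b v _ f hf hr,
    blockPf_eq_of_strictMono z l' b' v _ f hf hr]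
  refine pf_row_add z w N _ _ _ _ _ t (by rw [ht, ha]) (by rw [ht, hl]; ring) fun j hjt => ?_
  obtain ⟨h1, h2, h3⟩ := hj (f j) fun h => hjt (hf.injective (h.trans ht.symm))
  exact ⟨h1, h2, by rw [h3]⟩

/-- `Pf_{l/u}(a)` with the row `a_r = b_r + w t b'_r` is `Pf_{l/u}(b) + w Pf_{l'/u}(b')`, where
`l'` arises from `l` by lowering the entry `r` by one. -/
theorem skewPf_row_add (z w : R) {n : ℕ} (u : Fin n → ℕ) (l l' : Fin n → ℤ)
    (a b b' : Fin n → R⟦X⟧) (r : Fin n)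
    (ha : a r = b r + PowerSeries.C w * PowerSeries.X * b' r)
    (hl : l' r = l r - 1) (hj : ∀ j ≠ r, a j = b j ∧ a j = b' j ∧ l' j = l j) :
    skewPf z l u a = skewPf z l u b + w * skewPf z l' u b' := by
  unfold skewPf
  rw [Finset.mul_sum, ← Finset.sum_add_distrib]
  refine Finset.sum_congr rfl fun v hv => ?_
  obtain ⟨σ, -, rfl⟩ := Finset.mem_image.mp hv
  have hm : (u ∘ σ) r ∈ Finset.univ.image u := Finset.mem_image_of_mem u (Finset.mem_univ (σ r))
  -- Row `r` lies in exactly one block, so only that factor of the product changes.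
  rw [← Finset.mul_prod_erase _ _ hm, ← Finset.mul_prod_erase _ _ hm,
    ← Finset.mul_prod_erase _ _ hm, blockPf_row_add z w l l' a b b' _ r ha hl hj]
  have h1 : ∀ k ∈ (Finset.univ.image u).erase ((u ∘ σ) r), blockPf z l b (u ∘ σ) k =
      blockPf z l a (u ∘ σ) k := fun k hk => blockPf_congr _ _ _ _ _ _ _ fun i hi =>
    ⟨rfl, (hj i fun h => (Finset.mem_erase.mp hk).1 (by rw [← hi, h])).1.symm⟩
  have h2 : ∀ k ∈ (Finset.univ.image u).erase ((u ∘ σ) r), blockPf z l' b' (u ∘ σ) k =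
      blockPf z l a (u ∘ σ) k := fun k hk => blockPf_congr _ _ _ _ _ _ _ fun i hi =>
    have h := hj i fun h => (Finset.mem_erase.mp hk).1 (by rw [← hi, h])
    ⟨h.2.2, h.2.1.symm⟩
  rw [Finset.prod_congr rfl h1, Finset.prod_congr rfl h2]
  ring

theorem skewPf_eq_zero_of_neg (z : R) {n : ℕ} (u : Fin n → ℕ) (l : Fin n → ℤ)
    (c : Fin n → R⟦X⟧) (r : Fin n) (hr : l r < 0) (hj : ∀ j, r < j → l j ≤ 0) :
    skewPf z l u c = 0 := by
  refine Finset.sum_eq_zero fun v hv => ?_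
  obtain ⟨σ, -, rfl⟩ := Finset.mem_image.mp hv
  rw [Finset.prod_eq_zero (Finset.mem_image_of_mem u (Finset.mem_univ (σ r))), mul_zero]
  obtain ⟨N, f, hf, hk⟩ := exists_block (u ∘ σ) (u (σ r))
  obtain ⟨t, rfl⟩ := (hk r).mp rfl
  rw [blockPf_eq_of_strictMono z l c _ _ f hf hk]
  exact pf_eq_zero_of_neg z N _ _ t (by omega) fun j hjt => by
    have := hj _ (hf hjt); omega

theorem swap_lt_swap_iff {n : ℕ} {s s' : Fin n} (h : (s' : ℕ) = s + 1) {i j : Fin n}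
    (h1 : ¬(i = s ∧ j = s')) (h2 : ¬(i = s' ∧ j = s)) :
    Equiv.swap s s' i < Equiv.swap s s' j ↔ i < j := by
  simp only [Equiv.swap_apply_def, Fin.lt_def, Fin.ext_iff] at *
  split_ifs <;> omega

/-- Exchanging neighbours preserves the order of every other pair of positions, so only the pair
`(s, s')` is lost. -/
theorem inversions_comp_swap {n : ℕ} (v : Fin n → ℕ) {s s' : Fin n} (h : (s' : ℕ) = s + 1)
    (hv : v s < v s') : inversions v = inversions (v ∘ Equiv.swap s s') + 1 := by
  have hlt : s < s' := by rw [Fin.lt_def]; omega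
  unfold inversions
  have hm : (s, s') ∈ Finset.univ.filter fun p : Fin n × Fin n => p.1 < p.2 ∧ v p.1 < v p.2 := by
    simp [hlt, hv]
  rw [← Finset.card_erase_add_one hm]
  congr 1
  refine Finset.card_nbij' (fun p => (Equiv.swap s s' p.1, Equiv.swap s s' p.2))
    (fun p => (Equiv.swap s s' p.1, Equiv.swap s s' p.2)) ?_ ?_ ?_ ?_
  · rintro ⟨i, j⟩ hp
    simp only [Finset.coe_erase, Finset.coe_filter, Finset.mem_univ, true_and, Set.mem_sdiff,
      Set.mem_ofPred_eq, Set.mem_singleton_iff, Prod.mk.injEq] at hp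
    simp only [Finset.coe_filter, Finset.mem_univ, true_and, Set.mem_ofPred_eq, Function.comp_apply,
      Equiv.swap_apply_self]
    refine ⟨(swap_lt_swap_iff h hp.2 ?_).mpr hp.1.1, hp.1.2⟩
    rintro ⟨rfl, rfl⟩
    exact hlt.not_gt hp.1.1
  · rintro ⟨i, j⟩ hp
    simp only [Finset.coe_filter, Finset.mem_univ, true_and, Set.mem_ofPred_eq,
      Function.comp_apply] at hp
    have hne : ¬(i = s ∧ j = s') := by
      rintro ⟨rfl, rfl⟩
      have := hp.2
      rw [Equiv.swap_apply_left, Equiv.swap_apply_right] at this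
      exact hv.not_gt this
    have hne' : ¬(i = s' ∧ j = s) := by
      rintro ⟨rfl, rfl⟩
      exact hlt.not_gt hp.1
    simp only [Finset.coe_erase, Finset.coe_filter, Finset.mem_univ, true_and, Set.mem_sdiff,
      Set.mem_ofPred_eq, Set.mem_singleton_iff, Prod.mk.injEq]
    refine ⟨⟨(swap_lt_swap_iff h hne hne').mpr hp.1, hp.2⟩, ?_⟩
    rintro ⟨e1, e2⟩
    refine hne' ⟨?_, ?_⟩
    · rw [← Equiv.swap_apply_self s s' i, e1, Equiv.swap_apply_left]
    · rw [← Equiv.swap_apply_self s s' j, e2, Equiv.swap_apply_right]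
  · rintro ⟨i, j⟩ _; simp
  · rintro ⟨i, j⟩ _; simp

/-- Since no block contains both `s` and `s'`, the exchange carries an increasing enumeration of a
block to an increasing one, and it alters neither `l` nor `c`. -/
theorem blockPf_comp_swap (z : R) {n : ℕ} (l : Fin n → ℤ) (c : Fin n → R⟦X⟧)
    (v : Fin n → ℕ) (k : ℕ) {s s' : Fin n} (h : (s' : ℕ) = s + 1) (hl : l s = l s')
    (hc : c s = c s') (hv : v s ≠ v s') :
    blockPf z l c (v ∘ Equiv.swap s s') k = blockPf z l c v k := by
  obtain ⟨N, f, hf, hk⟩ := exists_block v k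
  have hl' : ∀ i, l (Equiv.swap s s' i) = l i := fun i => by
    rw [Equiv.swap_apply_def]; split_ifs with h1 h2 <;> simp [*]
  have hc' : ∀ i, c (Equiv.swap s s' i) = c i := fun i => by
    rw [Equiv.swap_apply_def]; split_ifs with h1 h2 <;> simp [*]
  rw [blockPf_eq_of_strictMono z l c v k f hf hk,
    blockPf_eq_of_strictMono z l c _ k (fun t => Equiv.swap s s' (f t))]
  · simp only [hl', hc']
  · intro i j hij
    have hne : ∀ i j : Fin N, ¬(f i = s ∧ f j = s') := fun i j hh => hv <| by
      rw [← hh.1, ← hh.2, (hk _).mpr ⟨i, rfl⟩, (hk _).mpr ⟨j, rfl⟩]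
    exact (swap_lt_swap_iff h (hne i j) fun hh => hne j i hh.symm).mpr (hf hij)
  · intro i
    rw [Function.comp_apply, hk]
    refine exists_congr fun t => ?_
    rw [Equiv.swap_apply_eq_iff]

/-- The skew pseudo-pfaffian with two equal neighbouring rows vanishes. -/
theorem skewPf_eq_zero_of_adjacent_eq (z : R) {n : ℕ} {u : Fin n → ℕ} (hu : IsStrictPartition u)
    (l : Fin n → ℤ) (c : Fin n → R⟦X⟧) {s s' : Fin n} (h : (s' : ℕ) = s + 1) (hl : l s = l s')
    (hc : c s = c s') (h0 : pf₂ z (l s) (l s) (c s) (c s) = 0) : skewPf z l u c = 0 := by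
  have hne : s ≠ s' := fun e => by rw [e] at h; omega
  have hzero : ∀ v ∈ Finset.univ.image (fun σ : Equiv.Perm (Fin n) => u ∘ σ), v s = v s' →
      (-1) ^ inversions v * ∏ k ∈ Finset.univ.image u, blockPf z l c v k = 0 := by
    intro v hv hvs
    obtain ⟨σ, -, rfl⟩ := Finset.mem_image.mp hv
    -- The only value a strict partition can repeat is $0$. The block in question is thus unshifted,
    -- and `h0` applies to it directly.
    have hz : (u ∘ σ) s = 0 := by
      simp only [Function.comp_apply] at hvs ⊢
      rcases lt_or_gt_of_ne (fun e => hne (σ.injective e) : σ s ≠ σ s') with hlt | hlt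
      · rcases hu _ _ hlt with h1 | h1
        · omega
        · exact h1.1
      · rcases hu _ _ hlt with h1 | h1
        · omega
        · exact h1.2
    rw [Finset.prod_eq_zero (Finset.mem_image_of_mem u (Finset.mem_univ (σ s))), mul_zero]
    obtain ⟨N, f, hf, hk⟩ := exists_block (u ∘ σ) (u (σ s))
    obtain ⟨t, ht⟩ := (hk s).mp rfl
    obtain ⟨t', ht'⟩ := (hk s').mp hvs.symm
    have hz' : u (σ s) = 0 := hz
    rw [blockPf_eq_of_strictMono z l c _ _ f hf hk]
    have htt : (t' : ℕ) = t + 1 := by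
      have h1 : t < t' := hf.lt_iff_lt.mp (by rw [ht, ht', Fin.lt_def]; omega)
      by_contra h2
      have h4 : (t : ℕ) + 1 < N := by have := t'.2; rw [Fin.lt_def] at h1; omega
      have h5 : f t < f ⟨t + 1, h4⟩ := hf (by rw [Fin.lt_def]; simp)
      have h6 : f ⟨t + 1, h4⟩ < f t' := hf (by rw [Fin.lt_def] at h1 ⊢; simp; omega)
      rw [ht, Fin.lt_def] at h5
      rw [ht', Fin.lt_def] at h6
      omega
    refine pf_eq_zero_of_adjacent_eq z N _ _ t t' htt (by rw [ht, ht', hl]) (by rw [ht, ht', hc]) ?_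
    simpa [ht, hz'] using h0
  -- Rearrangements with different values at `s` and `s'` cancel in pairs; those with equal values
  -- vanish one by one.
  refine Finset.sum_involution (fun v _ => v ∘ Equiv.swap s s') ?_ ?_ ?_ ?_
  · intro v hv
    by_cases hvs : v s = v s'
    · have : v ∘ Equiv.swap s s' = v := by
        funext i
        simp only [Function.comp_apply, Equiv.swap_apply_def]
        split_ifs with h1 h2 <;> simp [*]
      rw [this, hzero v hv hvs, add_zero]
    · simp only [blockPf_comp_swap z l c v _ h hl hc hvs]
      rw [← add_mul]
      rcases lt_or_gt_of_ne hvs with hlt | hlt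
      · rw [inversions_comp_swap v h hlt]; ring
      · rw [inversions_comp_swap (v ∘ Equiv.swap s s') h (by simpa using hlt)]
        have : (v ∘ Equiv.swap s s') ∘ Equiv.swap s s' = v := by
          funext i; simp
        rw [this]; ring
  · intro v hv hne0 he
    refine hne0 (hzero v hv ?_)
    have := congrFun he s
    simpa using this.symm
  · intro v hv
    obtain ⟨σ, -, rfl⟩ := Finset.mem_image.mp hv
    exact Finset.mem_image.mpr ⟨σ * Equiv.swap s s', Finset.mem_univ _, rfl⟩
  · intro v hv
    funext i; simp

theorem IsStrictPartition.antitone {n : ℕ} {l : Fin n → ℕ} (hl : IsStrictPartition l) :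
    Antitone l := fun i j hij => by
  rcases hij.lt_or_eq with h | rfl
  · rcases hl i j h with h | h <;> omega
  · exact le_rfl

theorem eq_of_comp_perm_of_antitone {n : ℕ} {l u : Fin n → ℕ} (hl : Antitone l) (hu : Antitone u)
    (σ : Equiv.Perm (Fin n)) (h : u ∘ σ = l) : u = l := by
  have h1 : (u ∘ σ) ∘ Fin.revPerm = u ∘ Fin.revPerm := by
    have ha : Monotone (u ∘ (Fin.revPerm.trans σ : Equiv.Perm (Fin n))) := by
      intro i j hij
      have : (u ∘ σ) (Fin.rev i) ≤ (u ∘ σ) (Fin.rev j) := by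
        rw [h]; exact hl (Fin.rev_le_rev.mpr hij)
      simpa using this
    have hb : Monotone (u ∘ (Fin.revPerm : Equiv.Perm (Fin n))) := fun i j hij => by
      simpa using hu (Fin.rev_le_rev.mpr hij)
    exact Tuple.unique_monotone ha hb
  funext i
  have := congrFun h1 (Fin.rev i)
  simp only [Function.comp_apply, Fin.revPerm_apply, Fin.rev_rev] at this
  rw [← h, Function.comp_apply, this]

/-- If some entry of the block exceeds `k`, so does its first entry. If some entry is below `k`,
then `k` is positive, so the block is that single row and its shifted entry is negative. -/
theorem blockPf_one (z : R) {n : ℕ} {l : Fin n → ℕ} (hl : IsStrictPartition l)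
    (v : Fin n → ℕ) (k : ℕ) (hv : k ≠ 0 → ∀ i j, v i = k → v j = k → i = j) :
    blockPf z (fun i => (l i : ℤ)) (fun _ => 1) v k = if ∀ i, v i = k → l i = k then 1 else 0 := by
  obtain ⟨N, f, hf, hk⟩ := exists_block v k
  rw [blockPf_eq_of_strictMono z _ _ v k f hf hk]
  split_ifs with h
  · have h1 : ∀ s, (l (f s) : ℤ) - k = 0 := fun s => by rw [h _ ((hk _).mpr ⟨s, rfl⟩), sub_self]
    simp only [h1, pf_one_zero]
  · push Not at h
    obtain ⟨i, hi, hne⟩ := h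
    obtain ⟨t, rfl⟩ := (hk i).mp hi
    rcases N with _ | N
    · exact t.elim0
    · rcases lt_or_ge k (l (f t)) with hlt | hge
      · have := hl.antitone (hf.monotone (Fin.zero_le t))
        exact pf_one_of_pos z _ (by omega)
      · have hlt := lt_of_le_of_ne hge hne
        refine pf_eq_zero_of_neg z _ _ _ t (by omega) fun j hj => ?_
        have := hv (by omega) _ _ hi ((hk _).mpr ⟨j, rfl⟩)
        exact absurd (hf.injective this) hj.ne

/-- `Pf_{l/u}(1)` is `1` for `l = u` and `0` otherwise. -/
theorem skewPf_one (z : R) {n : ℕ} {l u : Fin n → ℕ} (hl : IsStrictPartition l)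
    (hu : IsStrictPartition u) :
    skewPf z (fun i => (l i : ℤ)) u (fun _ => 1) = if u = l then 1 else 0 := by
  have hblock : ∀ v ∈ Finset.univ.image (fun σ : Equiv.Perm (Fin n) => u ∘ σ),
      (-1) ^ inversions v * ∏ k ∈ Finset.univ.image u, blockPf z (fun i => (l i : ℤ)) (fun _ => 1) v k =
        if v = l then (-1) ^ inversions l else 0 := by
    intro v hv
    obtain ⟨σ, -, rfl⟩ := Finset.mem_image.mp hv
    have hinj : ∀ k, k ≠ 0 → ∀ i j, (u ∘ σ) i = k → (u ∘ σ) j = k → i = j := by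
      intro k hk i j hi hj
      by_contra hij
      simp only [Function.comp_apply] at hi hj
      rcases lt_or_gt_of_ne (fun e => hij (σ.injective e) : σ i ≠ σ j) with hlt | hlt
      · rcases hu _ _ hlt with h1 | h1 <;> omega
      · rcases hu _ _ hlt with h1 | h1 <;> omega
    rw [Finset.prod_congr rfl fun k _ => blockPf_one z hl _ k (hinj k)]
    split_ifs with h
    · rw [Finset.prod_eq_one, mul_one, h]
      intro k _
      rw [if_pos]
      intro i hi; rw [← hi, h]
    · obtain ⟨i, hi⟩ := Function.ne_iff.mp h
      rw [Finset.prod_eq_zero (Finset.mem_image_of_mem u (Finset.mem_univ (σ i))), mul_zero]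
      rw [if_neg]
      intro hh
      exact hi (hh i rfl).symm
  unfold skewPf
  rw [Finset.sum_congr rfl hblock, Finset.sum_ite_eq']
  have hmem : l ∈ Finset.univ.image (fun σ : Equiv.Perm (Fin n) => u ∘ σ) ↔ u = l := by
    constructor
    · intro h
      obtain ⟨σ, -, h⟩ := Finset.mem_image.mp h
      exact eq_of_comp_perm_of_antitone hl.antitone hu.antitone σ h
    · rintro rfl
      exact Finset.mem_image.mpr ⟨1, Finset.mem_univ _, rfl⟩
  have hinv : inversions l = 0 := by
    unfold inversions
    rw [Finset.card_eq_zero, Finset.filter_eq_empty_iff]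
    rintro ⟨i, j⟩ _ ⟨h1, h2⟩
    exact absurd (hl.antitone h1.le) (not_le.mpr h2)
  simp only [hmem, hinv, pow_zero]

/-! ### Row-by-row expansion over horizontal and vertical strips. -/

theorem sum_piFinset_update {n : ℕ} (S : Fin n → Finset ℕ) (T : Finset ℕ) (r : Fin n) (a : ℕ)
    (hS : S r = {a}) (F : (Fin n → ℕ) → R) :
    ∑ ν ∈ Fintype.piFinset S, ∑ k ∈ T, F (Function.update ν r k) =
      ∑ ν ∈ Fintype.piFinset (Function.update S r T), F ν := by
  rw [← Finset.sum_product']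
  refine Finset.sum_nbij' (fun p => Function.update p.1 r p.2)
    (fun ν => (Function.update ν r a, ν r)) ?_ ?_ ?_ ?_ ?_
  · rintro ⟨ν, k⟩ h
    simp only [Finset.mem_product, Fintype.mem_piFinset] at h ⊢
    intro i
    by_cases hi : i = r
    · subst hi; simpa using h.2
    · simpa [hi] using h.1 i
  · intro ν h
    simp only [Finset.mem_product, Fintype.mem_piFinset] at h ⊢
    refine ⟨fun i => ?_, by simpa using h r⟩
    by_cases hi : i = r
    · subst hi; simp [hS]
    · simpa [hi] using h i
  · rintro ⟨ν, k⟩ h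
    simp only [Finset.mem_product, Fintype.mem_piFinset] at h
    have := h.1 r
    rw [hS, Finset.mem_singleton] at this
    simp [← this]
  · intro ν h
    simp
  · rintro ⟨ν, k⟩ h
    rfl

/-- Expanding the rows of a function one after the other, row `r` into a sum over `S r`. -/
theorem eq_sum_piFinset_of_row_expansion {n : ℕ} (l : Fin n → ℕ) (S : Fin n → Finset ℕ)
    (w : Fin n → ℕ → R) (Φ : ℕ → (Fin n → ℕ) → R)
    (h : ∀ (r : Fin n) (ν : Fin n → ℕ), (∀ i, r ≤ i → ν i = l i) →
      Φ r ν = ∑ k ∈ S r, w r k * Φ (r + 1) (Function.update ν r k)) :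
    Φ 0 l = ∑ ν ∈ Fintype.piFinset S, (∏ i, w i (ν i)) * Φ n ν := by
  -- State after `r` rounds: rows before `r` range over their sets `S i`, while the others are still
  -- frozen at `l i`.
  have key : ∀ r : ℕ, r ≤ n → Φ 0 l =
      ∑ ν ∈ Fintype.piFinset (fun i : Fin n => if (i : ℕ) < r then S i else {l i}),
        (∏ i : Fin n, if (i : ℕ) < r then w i (ν i) else 1) * Φ r ν := by
    intro r
    induction r with
    | zero =>
      intro _
      simp only [Nat.not_lt_zero, if_false, Finset.prod_const_one, one_mul]
      rw [Fintype.piFinset_singleton, Finset.sum_singleton]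
    | succ r ih =>
      intro hr
      rw [ih (by omega)]
      set q : Fin n := ⟨r, by omega⟩ with hq
      have h1 : (fun i : Fin n => if (i : ℕ) < r + 1 then S i else {l i}) =
          Function.update (fun i : Fin n => if (i : ℕ) < r then S i else {l i}) q (S q) := by
        funext i
        by_cases hi : i = q
        · subst hi; simp [hq]
        · have : (i : ℕ) ≠ r := fun e => hi (Fin.ext e)
          rw [Function.update_of_ne hi]
          exact if_congr (by omega) rfl rfl
      rw [h1, ← sum_piFinset_update _ (S q) q (l q) (by simp [hq])]
      refine Finset.sum_congr rfl fun ν hν => ?_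
      rw [Fintype.mem_piFinset] at hν
      have hνl : ∀ i, q ≤ i → ν i = l i := fun i hi => by
        have := hν i
        rw [if_neg (by rw [Fin.le_def] at hi; simp [hq] at hi; omega), Finset.mem_singleton] at this
        exact this
      rw [show Φ r ν = Φ (q : ℕ) ν from rfl, h q ν hνl, Finset.mul_sum]
      refine Finset.sum_congr rfl fun k _ => ?_
      rw [← mul_assoc]
      congr 1
      rw [← Finset.mul_prod_erase _ _ (Finset.mem_univ q),
        ← Finset.mul_prod_erase _ (fun i : Fin n => if (i : ℕ) < r + 1 then _ else _)
          (Finset.mem_univ q)]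
      simp only [hq, lt_irrefl, if_false, one_mul, Nat.lt_succ_self, if_true, Function.update_self]
      rw [mul_comm]
      congr 1
      refine Finset.prod_congr rfl fun i hi => ?_
      have hi' : i ≠ q := (Finset.mem_erase.mp hi).1
      have : (i : ℕ) ≠ r := fun e => hi' (Fin.ext e)
      rw [Function.update_of_ne hi']
      exact if_congr (by omega) rfl rfl
  rw [key n le_rfl]
  simp

/-- The entry of `l` after the entry `i`, or `0` if `i` is the last index. -/
def nextPart {n : ℕ} (l : Fin n → ℕ) (i : Fin n) : ℕ :=
  if h : (i : ℕ) + 1 < n then l ⟨i + 1, h⟩ else 0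

/-- The least possible entry `i` of a strict partition that arises from the strict partition `l`
by removing a horizontal strip of the shifted shape. -/
def hStripLower {n : ℕ} (l : Fin n → ℕ) (i : Fin n) : ℕ :=
  if nextPart l i = 0 then 0 else nextPart l i + 1

/-- The strict partitions that arise from the strict partition `l` by removing a horizontal strip
of the shifted shape. -/
def hStrips {n : ℕ} (l : Fin n → ℕ) : Finset (Fin n → ℕ) :=
  Fintype.piFinset fun i => Finset.Icc (hStripLower l i) (l i)

open Classical in
/-- The strict partitions that arise from the strict partition `l` by removing a vertical strip
of the shifted shape. -/
noncomputable def vStrips {n : ℕ} (l : Fin n → ℕ) : Finset (Fin n → ℕ) :=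
  (Fintype.piFinset fun i => Finset.Icc (l i - 1) (l i)).filter IsStrictPartition

theorem IsStrictPartition.hStripLower_le {n : ℕ} {l : Fin n → ℕ} (hl : IsStrictPartition l)
    (i : Fin n) : hStripLower l i ≤ l i := by
  unfold hStripLower
  split_ifs with h
  · exact Nat.zero_le _
  · unfold nextPart at h ⊢
    split_ifs at h ⊢ with h1
    · rcases hl i ⟨i + 1, h1⟩ (by rw [Fin.lt_def]; simp) with h2 | h2
      · exact h2
      · exact absurd h2.2 h
    · exact absurd rfl h

theorem IsStrictPartition.le_nextPart {n : ℕ} {l : Fin n → ℕ} (hl : IsStrictPartition l)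
    {i j : Fin n} (hij : i < j) : l j ≤ nextPart l i := by
  rw [Fin.lt_def] at hij
  have h : (i : ℕ) + 1 < n := by have := j.2; omega
  rw [nextPart, dif_pos h]
  exact hl.antitone (by rw [Fin.le_def]; simpa using hij)

theorem isStrictPartition_of_mem_hStrips {n : ℕ} {l κ : Fin n → ℕ} (hl : IsStrictPartition l)
    (hκ : κ ∈ hStrips l) : IsStrictPartition κ := by
  intro i j hij
  rw [hStrips, Fintype.mem_piFinset] at hκ
  have hi := Finset.mem_Icc.mp (hκ i)
  have hj := Finset.mem_Icc.mp (hκ j)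
  have h1 := hl.le_nextPart hij
  have h2 := hl.antitone hij.le
  unfold hStripLower at hi
  split_ifs at hi <;> omega

theorem eq_sum_Icc_of_recursion (x : R) (φ ψ : ℤ → R) (h : ∀ p, φ p = ψ p + x * φ (p - 1))
    (a : ℕ) (h0 : φ (a - 1) = 0) (p : ℕ) (hp : a ≤ p) :
    φ p = ∑ k ∈ Finset.Icc a p, x ^ (p - k) * ψ k := by
  induction p, hp using Nat.le_induction with
  | base => rw [h, h0]; simp
  | succ p hp ih =>
    rw [Finset.sum_Icc_succ_top (by omega), h, show ((p + 1 : ℕ) : ℤ) - 1 = p by push_cast; ring, ih,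
      Finset.mul_sum, add_comm]
    congr 1
    · refine Finset.sum_congr rfl fun k hk => ?_
      rw [Nat.succ_sub (Finset.mem_Icc.mp hk).2, pow_succ]; ring
    · simp

/-- If `e = f / (1 - x t)`, then `Pf_{l/u}(e)` is the sum of the `x^{|l| - |k|} Pf_{k/u}(f)` over all
`k` that arise from `l` by removing a horizontal strip. -/
theorem skewPf_eq_sum_hStrips (z x : R) {n : ℕ} {u l : Fin n → ℕ} (hu : IsStrictPartition u)
    (hl : IsStrictPartition l) (e f : R⟦X⟧) (hef : e = f + PowerSeries.C x * PowerSeries.X * e)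
    (h0 : ∀ p : ℤ, 0 < p → pf₂ z p p e e = 0) :
    skewPf z (fun i => (l i : ℤ)) u (fun _ => e) =
      ∑ κ ∈ hStrips l, (∏ i, x ^ (l i - κ i)) * skewPf z (fun i => (κ i : ℤ)) u (fun _ => f) := by
  -- Rows are treated from the top, so that row `r` is compared with a next row that still carries
  -- `e` and its original entry.
  have key := eq_sum_piFinset_of_row_expansion l (fun i => Finset.Icc (hStripLower l i) (l i))
    (fun i k => x ^ (l i - k))
    (fun r ν => skewPf z (fun i => (ν i : ℤ)) u (fun i => if (i : ℕ) < r then f else e)) ?_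
  · simpa only [hStrips, Nat.not_lt_zero, if_false, Fin.is_lt, if_true] using key
  · intro r ν hν
    have hrec := eq_sum_Icc_of_recursion x
      (fun p => skewPf z (Function.update (fun i => (ν i : ℤ)) r p) u
        (fun i => if (i : ℕ) < r then f else e))
      (fun p => skewPf z (Function.update (fun i => (ν i : ℤ)) r p) u
        (fun i => if (i : ℕ) < r + 1 then f else e)) ?_ (hStripLower l r) ?_ (l r)
      (hl.hStripLower_le r)
    · have h1 : Function.update (fun i => (ν i : ℤ)) r (l r : ℤ) = fun i => (ν i : ℤ) := by
        rw [← hν r le_rfl]; exact Function.update_eq_self r _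
      simp only [h1] at hrec
      rw [hrec]
      refine Finset.sum_congr rfl fun k _ => ?_
      congr 2
      funext i
      by_cases hi : i = r
      · subst hi; simp
      · simp [hi]
    · intro p
      refine skewPf_row_add z x u _ _ _ _ _ r ?_ ?_ ?_
      · simpa using hef
      · simp
      · intro j hj
        have : (j : ℕ) ≠ r := fun e => hj (Fin.ext e)
        exact ⟨if_congr (by omega) rfl rfl, rfl, by simp [hj]⟩
    -- The unrolling stops one below `hStripLower`: either at $-1$ with only zeros following, or at
    -- the next entry, where rows `r` and `r + 1` coincide.
    · by_cases hn : nextPart l r = 0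
      · refine skewPf_eq_zero_of_neg z u _ _ r (by simp [hStripLower, hn]) fun j hj => ?_
        have h1 := hl.le_nextPart hj
        rw [Function.update_of_ne hj.ne', hν j hj.le]
        omega
      · have h1 : (r : ℕ) + 1 < n := by
          by_contra h; exact hn (dif_neg h)
        have h2 : nextPart l r = l ⟨r + 1, h1⟩ := dif_pos h1
        have hne : (⟨r + 1, h1⟩ : Fin n) ≠ r := fun e => by
          have := congrArg Fin.val e; simp at this
        refine skewPf_eq_zero_of_adjacent_eq z hu _ _ (s := r) (s' := ⟨r + 1, h1⟩) rfl ?_ ?_ ?_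
        · rw [Function.update_self, Function.update_of_ne hne,
            hν ⟨r + 1, h1⟩ (by rw [Fin.le_def]; simp), ← h2, hStripLower, if_neg hn]
          push_cast; ring
        · simp
        · simp only [Function.update_self, lt_irrefl, if_false]
          refine h0 _ ?_
          rw [hStripLower, if_neg hn]
          push_cast; omega

/-- If `f = (1 + y t) c`, then `Pf_{l/u}(f)` is the sum of the `y^{|l| - |k|} Pf_{k/u}(c)` over all
`k` that arise from `l` by removing a vertical strip. -/
theorem skewPf_eq_sum_vStrips (z y : R) {n : ℕ} {u l : Fin n → ℕ} (hu : IsStrictPartition u)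
    (hl : IsStrictPartition l) (f c : R⟦X⟧) (hfc : f = c + PowerSeries.C y * PowerSeries.X * c)
    (h0 : ∀ p : ℤ, 0 < p → pf₂ z p p c c = 0) :
    skewPf z (fun i => (l i : ℤ)) u (fun _ => f) =
      ∑ κ ∈ vStrips l, (∏ i, y ^ (l i - κ i)) * skewPf z (fun i => (κ i : ℤ)) u (fun _ => c) := by
  classical
  have key := eq_sum_piFinset_of_row_expansion l (fun i => Finset.Icc (l i - 1) (l i))
    (fun i k => y ^ (l i - k))
    (fun r ν => skewPf z (fun i => (ν i : ℤ)) u (fun i => if (i : ℕ) < r then c else f)) ?_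
  · simp only [Nat.not_lt_zero, if_false, Fin.is_lt, if_true] at key
    -- Entries drop by at most one, so strictness can fail only when two neighbouring positive
    -- entries become equal. All rows carry `c` by then, and such terms vanish.
    rw [key, vStrips, Finset.sum_filter_of_ne]
    intro ν hν hne
    rw [Fintype.mem_piFinset] at hν
    by_contra hns
    unfold IsStrictPartition at hns
    push Not at hns
    obtain ⟨i, j, hij, h1, h2⟩ := hns
    have hi := Finset.mem_Icc.mp (hν i)
    have hj := Finset.mem_Icc.mp (hν j)
    have hlt : l j < l i := by
      rcases hl i j hij with h | h
      · exact h
      · exact absurd (by omega) (h2 (by omega))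
    have hj0 : ν j ≠ 0 := fun e => h2 (by omega) e
    have hadj : (j : ℕ) = i + 1 := by
      rw [Fin.lt_def] at hij
      by_contra hne'
      have h3 : (i : ℕ) + 1 < n := by have := j.2; omega
      rcases hl i ⟨i + 1, h3⟩ (by rw [Fin.lt_def]; simp) with h4 | h4 <;>
      rcases hl ⟨i + 1, h3⟩ j (by rw [Fin.lt_def]; simp; omega) with h5 | h5 <;> omega
    refine hne ?_
    have heq : (ν i : ℤ) = ν j := by
      have : ν i = ν j := by have := hl.antitone hij.le; omega
      rw [this]
    have hpos : (0 : ℤ) < ν i := by omega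
    have hzero := skewPf_eq_zero_of_adjacent_eq z hu (fun i => (ν i : ℤ)) (fun _ => c) hadj heq rfl
      (h0 _ hpos)
    rw [hzero, mul_zero]
  · intro r ν hν
    have h1 : skewPf z (fun i => (ν i : ℤ)) u (fun i => if (i : ℕ) < r then c else f) =
        skewPf z (fun i => (ν i : ℤ)) u (fun i => if (i : ℕ) < r + 1 then c else f) +
          y * skewPf z (Function.update (fun i => (ν i : ℤ)) r (ν r - 1 : ℤ)) u
            (fun i => if (i : ℕ) < r + 1 then c else f) := by
      refine skewPf_row_add z y u _ _ _ _ _ r ?_ ?_ ?_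
      · simpa using hfc
      · simp
      · intro j hj
        have : (j : ℕ) ≠ r := fun e => hj (Fin.ext e)
        exact ⟨if_congr (by omega) rfl rfl, if_congr (by omega) rfl rfl, by simp [hj]⟩
    have hr := hν r le_rfl
    rw [h1]
    -- For a zero entry, truncated subtraction reduces the interval to $\{0\}$; the lost term has
    -- entry $-1$ followed by zeros, hence is zero.
    rcases Nat.eq_zero_or_pos (l r) with hz | hp
    · rw [skewPf_eq_zero_of_neg z u (Function.update (fun i => (ν i : ℤ)) r (ν r - 1 : ℤ)) _ r
        (by rw [Function.update_self]; omega)]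
      · have hup : Function.update ν r 0 = ν := by
          rw [← hz, ← hr]; exact Function.update_eq_self r ν
        simp [hz, hup]
      · intro j hj
        have := hl.antitone hj.le
        rw [Function.update_of_ne hj.ne', hν j hj.le]
        omega
    · obtain ⟨k, hk⟩ := Nat.exists_eq_succ_of_ne_zero hp.ne'
      have hup : Function.update (fun i => (ν i : ℤ)) r (ν r - 1 : ℤ) =
          fun i => ((Function.update ν r k i : ℕ) : ℤ) := by
        funext i
        by_cases hi : i = r
        · subst hi; simp [hr, hk]
        · simp [hi]
      rw [hup, hk, Nat.succ_sub_one, Nat.succ_eq_add_one, Finset.sum_Icc_succ_top (by omega),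
        Finset.Icc_self, Finset.sum_singleton]
      have hup' : Function.update ν r (k + 1) = ν := by
        rw [show k + 1 = ν r by omega]; exact Function.update_eq_self r ν
      simp [hup']
      ring

/-! ### Strips in terms of the shifted diagram. -/

/-- Strict descent compensates the shift by one column per row: right ends of nonempty rows move
weakly left going down. -/
theorem IsStrictPartition.add_le_add {n : ℕ} {l : Fin n → ℕ} (hl : IsStrictPartition l)
    {i j : Fin n} (hij : i ≤ j) (hj : l j ≠ 0) : (j : ℕ) + l j ≤ i + l i := by
  obtain ⟨d, hd⟩ := Nat.exists_eq_add_of_le (Fin.le_def.mp hij)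
  induction d generalizing j with
  | zero =>
    obtain rfl : j = i := Fin.ext (by simpa using hd)
    exact le_rfl
  | succ d ih =>
    have hlt : (i : ℕ) + d < n := by have := j.2; omega
    have h1 : l j < l ⟨i + d, hlt⟩ := by
      rcases hl ⟨i + d, hlt⟩ j (by rw [Fin.lt_def]; simp; omega) with h | h
      · exact h
      · exact absurd h.2 hj
    have h2 := ih (j := ⟨i + d, hlt⟩) (by rw [Fin.le_def]; simp) (by omega) rfl
    simp only at h2
    omega

/-- The last condition says that no removed box of row `i` has a box of a lower row in its column.
By `add_le_add` it suffices to test the next row, and this is the bound `hStripLower`. -/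
theorem mem_hStrips_iff {n : ℕ} {l : Fin n → ℕ} (hl : IsStrictPartition l) (κ : Fin n → ℕ) :
    κ ∈ hStrips l ↔ IsStrictPartition κ ∧ (∀ i, κ i ≤ l i) ∧
      ∀ i j : Fin n, i < j → l j ≠ 0 → (j : ℕ) + l j ≤ i + κ i := by
  constructor
  · intro h
    refine ⟨isStrictPartition_of_mem_hStrips hl h, ?_, ?_⟩
    · rw [hStrips, Fintype.mem_piFinset] at h
      exact fun i => (Finset.mem_Icc.mp (h i)).2
    · intro i j hij hj
      rw [hStrips, Fintype.mem_piFinset] at h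
      have h1 := (Finset.mem_Icc.mp (h i)).1
      have h2 := hl.le_nextPart hij
      rw [Fin.lt_def] at hij
      have h3 : (i : ℕ) + 1 < n := by have := j.2; omega
      have h4 : nextPart l i = l ⟨i + 1, h3⟩ := dif_pos h3
      have h5 := hl.add_le_add (i := ⟨i + 1, h3⟩) (j := j) (by rw [Fin.le_def]; exact hij) hj
      rw [hStripLower, if_neg (by omega)] at h1
      simp only at h5
      omega
  · rintro ⟨-, h1, h2⟩
    rw [hStrips, Fintype.mem_piFinset]
    intro i
    rw [Finset.mem_Icc]
    refine ⟨?_, h1 i⟩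
    unfold hStripLower
    split_ifs with h3
    · exact Nat.zero_le _
    · have h4 : (i : ℕ) + 1 < n := by
        by_contra h
        exact h3 (dif_neg h)
      have h5 : nextPart l i = l ⟨i + 1, h4⟩ := dif_pos h4
      have := h2 i ⟨i + 1, h4⟩ (by rw [Fin.lt_def]; simp) (by omega)
      simp only at this
      omega

theorem mem_vStrips_iff {n : ℕ} (l κ : Fin n → ℕ) :
    κ ∈ vStrips l ↔ IsStrictPartition κ ∧ (∀ i, κ i ≤ l i) ∧ ∀ i, l i ≤ κ i + 1 := by
  simp only [vStrips, Finset.mem_filter, Fintype.mem_piFinset, Finset.mem_Icc]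
  constructor
  · rintro ⟨h1, h2⟩
    exact ⟨h2, fun i => (h1 i).2, fun i => by have := (h1 i).1; omega⟩
  · rintro ⟨h1, h2, h3⟩
    exact ⟨fun i => ⟨by have := h3 i; omega, h2 i⟩, h1⟩

/-! ### Letters, and the subshape filled by the first letters. -/

/-- The position of the letter in the alphabet `1' < 1 < 2' < 2 < ⋯`, starting from `0`. -/
def Letter.rank {m : ℕ} (e : Letter m) : ℕ :=
  2 * ((ofLex e).1 : ℕ) + if (ofLex e).2 then 1 else 0

theorem Letter.rank_le_rank_iff {m : ℕ} (e e' : Letter m) : e.rank ≤ e'.rank ↔ e ≤ e' := by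
  rw [Prod.Lex.le_iff]
  unfold Letter.rank
  rw [Fin.lt_def, Fin.ext_iff]
  rcases h : (ofLex e).2 <;> rcases h' : (ofLex e').2 <;> simp <;> omega

theorem Letter.rank_injective {m : ℕ} : Function.Injective (Letter.rank : Letter m → ℕ) :=
  fun e e' h => le_antisymm ((rank_le_rank_iff e e').mp h.le) ((rank_le_rank_iff e' e).mp h.ge)

theorem Letter.rank_lt {m : ℕ} (e : Letter m) : e.rank < 2 * m := by
  unfold Letter.rank
  have := (ofLex e).1.2
  split_ifs <;> omega

theorem mem_shiftedSkewShape {n : ℕ} {l u : Fin n → ℕ} {b : (_ : Fin n) × ℕ} :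
    b ∈ shiftedSkewShape l u ↔ (b.1 : ℕ) + u b.1 ≤ b.2 ∧ b.2 < b.1 + l b.1 := by
  simp [shiftedSkewShape]

theorem shiftedSkewShape_mono {n : ℕ} {l κ : Fin n → ℕ} (h : ∀ i, κ i ≤ l i) (u : Fin n → ℕ) :
    shiftedSkewShape κ u ⊆ shiftedSkewShape l u := fun b hb => by
  rw [mem_shiftedSkewShape] at hb ⊢
  have := h b.1
  omega

open Classical in
/-- The tableaux on `l/u` with entries among the first `N` letters of the alphabet. -/
noncomputable def tableauxBelow {n : ℕ} (l u : Fin n → ℕ) (m N : ℕ) :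
    Finset (shiftedSkewShape l u → Letter m) :=
  (tableaux l u m).filter fun T => ∀ b, (T b).rank < N

theorem mem_tableauxBelow {n : ℕ} {l u : Fin n → ℕ} {m N : ℕ}
    {T : shiftedSkewShape l u → Letter m} :
    T ∈ tableauxBelow l u m N ↔ IsTableau T ∧ ∀ b, (T b).rank < N := by
  simp [tableauxBelow, tableaux]

open Classical in
/-- The columns of the boxes in row `i` of a filling of `l/u` with entries among the first `N`
letters. -/
noncomputable def rowBelow {n m : ℕ} {l u : Fin n → ℕ} (T : shiftedSkewShape l u → Letter m)
    (N : ℕ) (i : Fin n) : Finset ℕ :=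
  (Finset.Ico ((i : ℕ) + u i) (i + l i)).filter fun j =>
    ∃ h : (⟨i, j⟩ : (_ : Fin n) × ℕ) ∈ shiftedSkewShape l u, (T ⟨_, h⟩).rank < N

/-- The shape of the part of a filling of `l/u` with entries among the first `N` letters. -/
noncomputable def shapeBelow {n m : ℕ} {l u : Fin n → ℕ} (T : shiftedSkewShape l u → Letter m)
    (N : ℕ) (i : Fin n) : ℕ :=
  u i + (rowBelow T N i).card

theorem eq_Ico_of_lower_closed {a b : ℕ} {s : Finset ℕ} (hs : s ⊆ Finset.Ico a b)
    (h : ∀ i j, a ≤ i → i < j → j ∈ s → i ∈ s) : s = Finset.Ico a (a + s.card) := by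
  rcases s.eq_empty_or_nonempty with rfl | hne
  · simp
  · have h1 : s = Finset.Ico a (s.max' hne + 1) := by
      ext i
      rw [Finset.mem_Ico]
      constructor
      · intro hi
        exact ⟨(Finset.mem_Ico.mp (hs hi)).1, Nat.lt_succ_of_le (s.le_max' i hi)⟩
      · rintro ⟨h1, h2⟩
        rcases (Nat.le_of_lt_succ h2).lt_or_eq with h3 | h3
        · exact h i _ h1 h3 (s.max'_mem hne)
        · rw [h3]; exact s.max'_mem hne
    have h2 : s.card = s.max' hne + 1 - a := by
      conv_lhs => rw [h1]
      simp
    have h3 := (Finset.mem_Ico.mp (hs (s.max'_mem hne))).1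
    conv_lhs => rw [h1]
    rw [h2]
    congr 1
    omega

section ShapeBelow

variable {n m : ℕ} {l u : Fin n → ℕ} {T : shiftedSkewShape l u → Letter m}

theorem le_shapeBelow (N : ℕ) (i : Fin n) : u i ≤ shapeBelow T N i := Nat.le_add_right _ _

theorem rowBelow_subset (N : ℕ) (i : Fin n) :
    rowBelow T N i ⊆ Finset.Ico ((i : ℕ) + u i) (i + l i) := Finset.filter_subset _ _

theorem mem_rowBelow {N j : ℕ} {i : Fin n} : j ∈ rowBelow T N i ↔
    ∃ h : (⟨i, j⟩ : (_ : Fin n) × ℕ) ∈ shiftedSkewShape l u, (T ⟨_, h⟩).rank < N := by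
  refine Finset.mem_filter.trans (and_iff_right_of_imp ?_)
  rintro ⟨h, -⟩
  exact Finset.mem_Ico.mpr (mem_shiftedSkewShape.mp h)

theorem shapeBelow_le (hul : ∀ i, u i ≤ l i) (N : ℕ) (i : Fin n) : shapeBelow T N i ≤ l i := by
  have h1 := Finset.card_le_card (rowBelow_subset (T := T) N i)
  have h2 := hul i
  rw [Nat.card_Ico] at h1
  unfold shapeBelow
  omega

/-- Rows increase weakly, so the boxes with small letters form an initial segment of each row and
are determined by their number. -/
theorem lt_shapeBelow_iff (hT : IsTableau T) (N : ℕ) (b : shiftedSkewShape l u) :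
    b.1.2 < b.1.1 + shapeBelow T N b.1.1 ↔ (T b).rank < N := by
  obtain ⟨⟨i, j⟩, hb⟩ := b
  have hmem := mem_shiftedSkewShape.mp hb
  have h := eq_Ico_of_lower_closed (rowBelow_subset (T := T) N i) (by
      intro j j' hj hjj hj'
      obtain ⟨h2, h3⟩ := mem_rowBelow.mp hj'
      have h4 : (⟨i, j⟩ : (_ : Fin n) × ℕ) ∈ shiftedSkewShape l u :=
        mem_shiftedSkewShape.mpr ⟨hj, hjj.trans (mem_shiftedSkewShape.mp h2).2⟩
      refine mem_rowBelow.mpr ⟨h4, ?_⟩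
      exact ((Letter.rank_le_rank_iff _ _).mpr (hT.row_le ⟨_, h4⟩ ⟨_, h2⟩ rfl hjj)).trans_lt h3)
  have h1 := Finset.ext_iff.mp h j
  rw [mem_rowBelow, Finset.mem_Ico, and_iff_right hmem.1, add_assoc] at h1
  exact h1.symm.trans ⟨fun h => h.2, fun h => ⟨hb, h⟩⟩

/-- Above the last small box of row `j`, row `i` has a box of `u` or, by column monotonicity,
another small box. Row `i` thus reaches at least as far right, which the shift turns into a strict
inequality. -/
theorem isStrictPartition_shapeBelow (hu : IsStrictPartition u) (hl : IsStrictPartition l)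
    (hul : ∀ i, u i ≤ l i) (hT : IsTableau T) (N : ℕ) : IsStrictPartition (shapeBelow T N) := by
  intro i j hij
  have hi := le_shapeBelow (T := T) N i
  have hj := le_shapeBelow (T := T) N j
  have hjl := shapeBelow_le (T := T) hul N j
  have hij' := Fin.lt_def.mp hij
  by_cases h0 : shapeBelow T N j = 0
  · by_cases h1 : shapeBelow T N i = 0
    · exact Or.inr ⟨h1, h0⟩
    · left; omega
  left
  rcases hj.lt_or_eq with hlt | heq
  · have hadd := hl.add_le_add hij.le (show l j ≠ 0 by omega)
    by_cases hc : (j : ℕ) + shapeBelow T N j - 1 < i + u i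
    · omega
    · have hbj : (⟨j, j + shapeBelow T N j - 1⟩ : (_ : Fin n) × ℕ) ∈ shiftedSkewShape l u :=
        mem_shiftedSkewShape.mpr (by simp only; omega)
      have hbi : (⟨i, j + shapeBelow T N j - 1⟩ : (_ : Fin n) × ℕ) ∈ shiftedSkewShape l u :=
        mem_shiftedSkewShape.mpr (by simp only; omega)
      have h1 := (lt_shapeBelow_iff hT N ⟨_, hbj⟩).mp (by simp only; omega)
      have h2 := (Letter.rank_le_rank_iff _ _).mpr (hT.col_le ⟨_, hbi⟩ ⟨_, hbj⟩ rfl hij)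
      have h3 := (lt_shapeBelow_iff hT N ⟨_, hbi⟩).mpr (h2.trans_lt h1)
      simp only at h3
      omega
  · rcases hu i j hij with h | h <;> omega

/-- Otherwise the column of the last box of row `j` would contain the letter `e` in both rows. -/
theorem shapeBelow_hStrip (hu : IsStrictPartition u) (hl : IsStrictPartition l)
    (hul : ∀ i, u i ≤ l i) (hT : IsTableau T) {e : Letter m} (he : e.IsPlain)
    (hTe : ∀ b, (T b).rank < e.rank + 1) (i j : Fin n) (hij : i < j) (hj : l j ≠ 0) :
    (j : ℕ) + l j ≤ i + shapeBelow T e.rank i := by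
  by_contra hlt
  have hi := le_shapeBelow (T := T) e.rank i
  have hadd := hl.add_le_add hij.le hj
  have hij' := Fin.lt_def.mp hij
  rcases (hul j).lt_or_eq with h | h
  · have hbj : (⟨j, j + l j - 1⟩ : (_ : Fin n) × ℕ) ∈ shiftedSkewShape l u :=
      mem_shiftedSkewShape.mpr (by simp only; omega)
    have hbi : (⟨i, j + l j - 1⟩ : (_ : Fin n) × ℕ) ∈ shiftedSkewShape l u :=
      mem_shiftedSkewShape.mpr (by simp only; omega)
    have h1 := mt (lt_shapeBelow_iff hT e.rank ⟨_, hbi⟩).mpr (by simp only; omega)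
    have h2 := (Letter.rank_le_rank_iff _ _).mpr (hT.col_le ⟨_, hbi⟩ ⟨_, hbj⟩ rfl hij)
    have h3 := hTe ⟨_, hbi⟩
    have h4 := hTe ⟨_, hbj⟩
    have h5 : T ⟨_, hbi⟩ = e := Letter.rank_injective (by omega)
    have h6 : T ⟨_, hbj⟩ = e := Letter.rank_injective (by omega)
    exact hT.plain_col ⟨_, hbi⟩ ⟨_, hbj⟩ rfl hij (by rw [h5]; exact he) (by rw [h5, h6])
  · have := hu.add_le_add hij.le (show u j ≠ 0 by omega)
    omega

theorem shapeBelow_vStrip (hT : IsTableau T) {e : Letter m} (he : e.IsPrimed)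
    (hTe : ∀ b, (T b).rank < e.rank + 1) (i : Fin n) : l i ≤ shapeBelow T e.rank i + 1 := by
  by_contra hlt
  have hi := le_shapeBelow (T := T) e.rank i
  have hb : (⟨i, i + shapeBelow T e.rank i⟩ : (_ : Fin n) × ℕ) ∈ shiftedSkewShape l u :=
    mem_shiftedSkewShape.mpr (by simp only; omega)
  have hb' : (⟨i, i + shapeBelow T e.rank i + 1⟩ : (_ : Fin n) × ℕ) ∈ shiftedSkewShape l u :=
    mem_shiftedSkewShape.mpr (by simp only; omega)
  have h1 := mt (lt_shapeBelow_iff hT e.rank ⟨_, hb⟩).mpr (by simp only; omega)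
  have h1' := mt (lt_shapeBelow_iff hT e.rank ⟨_, hb'⟩).mpr (by simp only; omega)
  have h3 := hTe ⟨_, hb⟩
  have h4 := hTe ⟨_, hb'⟩
  have h5 : T ⟨_, hb⟩ = e := Letter.rank_injective (by omega)
  have h6 : T ⟨_, hb'⟩ = e := Letter.rank_injective (by omega)
  exact hT.primed_row ⟨_, hb⟩ ⟨_, hb'⟩ rfl (Nat.lt_succ_self _) (by rw [h5]; exact he)
    (by rw [h5, h6])

theorem shapeBelow_eq_of_iff {κ : Fin n → ℕ} (hT : IsTableau T) (hul : ∀ i, u i ≤ l i)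
    (huκ : ∀ i, u i ≤ κ i) (hκl : ∀ i, κ i ≤ l i) (N : ℕ)
    (h : ∀ b : shiftedSkewShape l u, b.1.2 < b.1.1 + κ b.1.1 ↔ (T b).rank < N) :
    shapeBelow T N = κ := by
  funext i
  have h1 := le_shapeBelow (T := T) N i
  have h2 := shapeBelow_le (T := T) hul N i
  have h3 := huκ i
  have h4 := hκl i
  by_contra hne
  rcases lt_or_gt_of_ne hne with hlt | hlt
  · have hb : (⟨i, i + shapeBelow T N i⟩ : (_ : Fin n) × ℕ) ∈ shiftedSkewShape l u :=
      mem_shiftedSkewShape.mpr (by simp only; omega)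
    have := (lt_shapeBelow_iff hT N ⟨_, hb⟩).mpr ((h ⟨_, hb⟩).mp (by simp only; omega))
    simp at this
  · have hb : (⟨i, i + κ i⟩ : (_ : Fin n) × ℕ) ∈ shiftedSkewShape l u :=
      mem_shiftedSkewShape.mpr (by simp only; omega)
    have := (h ⟨_, hb⟩).mpr ((lt_shapeBelow_iff hT N ⟨_, hb⟩).mp (by simp only; omega))
    simp at this

end ShapeBelow

/-! ### Adding a strip filled with a new largest letter. -/

section Extend

variable {n m : ℕ} {l u κ : Fin n → ℕ}

open Classical in
/-- The filling of `l/u` that extends a filling of `k/u` by the constant letter `e`. -/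
noncomputable def extendBy (l : Fin n → ℕ) (T : shiftedSkewShape κ u → Letter m) (e : Letter m)
    (b : shiftedSkewShape l u) : Letter m :=
  if h : b.1 ∈ shiftedSkewShape κ u then T ⟨b.1, h⟩ else e

theorem extendBy_of_mem (T : shiftedSkewShape κ u → Letter m) (e : Letter m)
    (b : shiftedSkewShape l u) (h : b.1 ∈ shiftedSkewShape κ u) :
    extendBy l T e b = T ⟨b.1, h⟩ := dif_pos h

theorem extendBy_of_notMem (T : shiftedSkewShape κ u → Letter m) (e : Letter m)
    (b : shiftedSkewShape l u) (h : b.1 ∉ shiftedSkewShape κ u) :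
    extendBy l T e b = e := dif_neg h

/-- Boxes to the left of or above a box of `κ/u` within `l/u` stay in `κ/u`, so the new letter never
precedes an old one; the strip conditions exclude forbidden repetitions of `e`. -/
theorem isTableau_extendBy {T : shiftedSkewShape κ u → Letter m} {e : Letter m}
    (hκ : IsStrictPartition κ) (hT : IsTableau T) (hTe : ∀ b, (T b).rank < e.rank)
    (hp : e.IsPlain → ∀ i j : Fin n, i < j → l j ≠ 0 → (j : ℕ) + l j ≤ i + κ i)
    (hq : e.IsPrimed → ∀ i, l i ≤ κ i + 1) : IsTableau (extendBy l T e) := by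
  have hle : ∀ b, extendBy l T e b ≤ e := fun b => by
    by_cases h : b.1 ∈ shiftedSkewShape κ u
    · rw [extendBy_of_mem T e b h]
      exact (Letter.rank_le_rank_iff _ _).mp (hTe _).le
    · rw [extendBy_of_notMem T e b h]
  have hne : ∀ b, b.1 ∈ shiftedSkewShape κ u → extendBy l T e b ≠ e := fun b h heq => by
    rw [extendBy_of_mem T e b h] at heq
    have := hTe ⟨b.1, h⟩
    rw [heq] at this
    exact this.false
  have hrow : ∀ b c : shiftedSkewShape l u, b.1.1 = c.1.1 → b.1.2 < c.1.2 →
      c.1 ∈ shiftedSkewShape κ u → b.1 ∈ shiftedSkewShape κ u := by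
    rintro ⟨⟨i, j⟩, hb⟩ ⟨⟨i', j'⟩, hc⟩ h1 h2 h3
    simp only at h1 h2 h3 ⊢
    subst h1
    rw [mem_shiftedSkewShape] at *
    simp only at *
    omega
  have hcol : ∀ b c : shiftedSkewShape l u, b.1.2 = c.1.2 → b.1.1 < c.1.1 →
      c.1 ∈ shiftedSkewShape κ u → b.1 ∈ shiftedSkewShape κ u := by
    rintro ⟨⟨i, j⟩, hb⟩ ⟨⟨i', j'⟩, hc⟩ h1 h2 h3
    simp only at h1 h2 h3 ⊢
    subst h1
    rw [mem_shiftedSkewShape] at *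
    simp only at *
    have := hκ.add_le_add h2.le (by omega)
    omega
  refine ⟨fun b c h1 h2 => ?_, fun b c h1 h2 => ?_, fun b c h1 h2 h3 => ?_,
    fun b c h1 h2 h3 => ?_⟩
  · by_cases hc : c.1 ∈ shiftedSkewShape κ u
    · rw [extendBy_of_mem T e b (hrow b c h1 h2 hc), extendBy_of_mem T e c hc]
      exact hT.row_le ⟨_, _⟩ ⟨_, _⟩ h1 h2
    · rw [extendBy_of_notMem T e c hc]
      exact hle b
  · by_cases hc : c.1 ∈ shiftedSkewShape κ u
    · rw [extendBy_of_mem T e b (hcol b c h1 h2 hc), extendBy_of_mem T e c hc]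
      exact hT.col_le ⟨_, _⟩ ⟨_, _⟩ h1 h2
    · rw [extendBy_of_notMem T e c hc]
      exact hle b
  · by_cases hc : c.1 ∈ shiftedSkewShape κ u
    · rw [extendBy_of_mem T e b (hcol b c h1 h2 hc)] at h3 ⊢
      rw [extendBy_of_mem T e c hc]
      exact hT.plain_col ⟨_, _⟩ ⟨_, _⟩ h1 h2 h3
    · rw [extendBy_of_notMem T e c hc]
      by_cases hb : b.1 ∈ shiftedSkewShape κ u
      · exact hne b hb
      · rw [extendBy_of_notMem T e b hb] at h3
        have hcm := mem_shiftedSkewShape.mp c.2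
        have hbm := mem_shiftedSkewShape.mp b.2
        have := hp h3 b.1.1 c.1.1 h2 (by omega)
        exact absurd (mem_shiftedSkewShape.mpr ⟨hbm.1, by omega⟩) hb
  · by_cases hc : c.1 ∈ shiftedSkewShape κ u
    · rw [extendBy_of_mem T e b (hrow b c h1 h2 hc)] at h3 ⊢
      rw [extendBy_of_mem T e c hc]
      exact hT.primed_row ⟨_, _⟩ ⟨_, _⟩ h1 h2 h3
    · rw [extendBy_of_notMem T e c hc]
      by_cases hb : b.1 ∈ shiftedSkewShape κ u
      · exact hne b hb
      · rw [extendBy_of_notMem T e b hb] at h3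
        have hcm := mem_shiftedSkewShape.mp c.2
        have hbm := mem_shiftedSkewShape.mp b.2
        have := hq h3 b.1.1
        rw [← h1] at hcm
        exact absurd (mem_shiftedSkewShape.mpr ⟨hbm.1, by omega⟩) hb

theorem prod_weight_extendBy (x y : Fin m → R) (huκ : ∀ i, u i ≤ κ i) (hκl : ∀ i, κ i ≤ l i)
    (T : shiftedSkewShape κ u → Letter m) (e : Letter m) :
    ∏ b, (extendBy l T e b).weight x y =
      (∏ i, (e.weight x y) ^ (l i - κ i)) * ∏ b, (T b).weight x y := by
  classical
  set F : (_ : Fin n) × ℕ → R := fun b =>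
    if h : b ∈ shiftedSkewShape κ u then (T ⟨b, h⟩).weight x y else e.weight x y with hF
  have h1 : ∏ b, (extendBy l T e b).weight x y = ∏ b ∈ shiftedSkewShape l u, F b := by
    rw [← Finset.prod_coe_sort (shiftedSkewShape l u) F]
    refine Finset.prod_congr rfl fun b _ => ?_
    simp only [hF, extendBy]
    split_ifs <;> rfl
  have h2 : ∏ b, (T b).weight x y = ∏ b ∈ shiftedSkewShape κ u, F b := by
    rw [← Finset.prod_coe_sort (shiftedSkewShape κ u) F]
    refine Finset.prod_congr rfl fun b _ => ?_
    simp only [hF, b.2, dif_pos]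
  rw [h1, h2, shiftedSkewShape, shiftedSkewShape, Finset.prod_sigma, Finset.prod_sigma,
    ← Finset.prod_mul_distrib]
  refine Finset.prod_congr rfl fun i _ => ?_
  rw [← Finset.prod_Ico_consecutive _ (Nat.add_le_add_left (huκ i) i) (Nat.add_le_add_left (hκl i) i),
    mul_comm]
  congr 1
  rw [Finset.prod_congr rfl (g := fun _ => e.weight x y), Finset.prod_const, Nat.card_Ico]
  · congr 1; omega
  · intro j hj
    rw [Finset.mem_Ico] at hj
    simp only [hF]
    rw [dif_neg]
    rw [mem_shiftedSkewShape]
    simp only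
    omega

end Extend

/-! ### Recursion for the tableau sums. -/

open Classical in
/-- The sum over the tableaux on `l/u` with entries among the first `N` letters, which is `0`
unless `u` is contained in `l`. -/
noncomputable def tableauxSum {n m : ℕ} (x y : Fin m → R) (l u : Fin n → ℕ) (N : ℕ) : R :=
  if ∀ i, u i ≤ l i then ∑ T ∈ tableauxBelow l u m N, ∏ b, (T b).weight x y else 0

/-- Restriction to `κ/u` and extension by `e` are inverse: outside the subshape, the rank bounds
leave `e` as the only possible letter. -/
theorem sum_fiber_shapeBelow {n m : ℕ} (x y : Fin m → R) {l u κ : Fin n → ℕ}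
    (hκ : IsStrictPartition κ) (hul : ∀ i, u i ≤ l i)
    (huκ : ∀ i, u i ≤ κ i) (hκl : ∀ i, κ i ≤ l i) (e : Letter m)
    (hp : e.IsPlain → ∀ i j : Fin n, i < j → l j ≠ 0 → (j : ℕ) + l j ≤ i + κ i)
    (hq : e.IsPrimed → ∀ i, l i ≤ κ i + 1) :
    ∑ T ∈ (tableauxBelow l u m (e.rank + 1)).filter (fun T => shapeBelow T e.rank = κ),
      ∏ b, (T b).weight x y =
    (∏ i, (e.weight x y) ^ (l i - κ i)) *
      ∑ T ∈ tableauxBelow κ u m e.rank, ∏ b, (T b).weight x y := by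
  rw [Finset.mul_sum]
  have hsub := shiftedSkewShape_mono hκl u
  have hext : ∀ T : shiftedSkewShape l u → Letter m, IsTableau T →
      (∀ b, (T b).rank < e.rank + 1) → shapeBelow T e.rank = κ →
      extendBy l (fun b : shiftedSkewShape κ u => T ⟨b.1, hsub b.2⟩) e = T := by
    intro T hT hTe hs
    funext b
    by_cases hb : b.1 ∈ shiftedSkewShape κ u
    · rw [extendBy_of_mem _ _ _ hb]
    · rw [extendBy_of_notMem _ _ _ hb]
      have h1 := mt (lt_shapeBelow_iff hT e.rank b).mpr fun h => hb <|
        mem_shiftedSkewShape.mpr ⟨(mem_shiftedSkewShape.mp b.2).1, by rw [← hs]; exact h⟩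
      have h2 := hTe b
      exact Letter.rank_injective (by omega)
  refine Finset.sum_nbij' (fun T b => T ⟨b.1, hsub b.2⟩) (fun T => extendBy l T e) ?_ ?_ ?_ ?_ ?_
  · intro T hT
    obtain ⟨h1, hs⟩ := Finset.mem_filter.mp hT
    obtain ⟨hT, hTe⟩ := mem_tableauxBelow.mp h1
    refine mem_tableauxBelow.mpr ⟨⟨fun b c => hT.row_le ⟨_, _⟩ ⟨_, _⟩,
      fun b c => hT.col_le ⟨_, _⟩ ⟨_, _⟩, fun b c => hT.plain_col ⟨_, _⟩ ⟨_, _⟩,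
      fun b c => hT.primed_row ⟨_, _⟩ ⟨_, _⟩⟩, fun b => ?_⟩
    refine (lt_shapeBelow_iff hT e.rank ⟨b.1, hsub b.2⟩).mp ?_
    rw [hs]
    exact (mem_shiftedSkewShape.mp b.2).2
  · intro T hT
    obtain ⟨hT, hTe⟩ := mem_tableauxBelow.mp hT
    have hE := isTableau_extendBy (l := l) hκ hT hTe hp hq
    have hiff : ∀ b : shiftedSkewShape l u,
        b.1.2 < b.1.1 + κ b.1.1 ↔ (extendBy l T e b).rank < e.rank := by
      intro b
      have hbm := mem_shiftedSkewShape.mp b.2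
      by_cases hb : b.1 ∈ shiftedSkewShape κ u
      · rw [extendBy_of_mem _ _ _ hb]
        exact iff_of_true (mem_shiftedSkewShape.mp hb).2 (hTe _)
      · rw [extendBy_of_notMem _ _ _ hb]
        exact iff_of_false (fun h => hb (mem_shiftedSkewShape.mpr ⟨hbm.1, h⟩)) (lt_irrefl _)
    refine Finset.mem_filter.mpr ⟨mem_tableauxBelow.mpr ⟨hE, fun b => ?_⟩,
      shapeBelow_eq_of_iff hE hul huκ hκl _ hiff⟩
    by_cases hb : b.1 ∈ shiftedSkewShape κ u
    · rw [extendBy_of_mem _ _ _ hb]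
      exact (hTe _).trans (Nat.lt_succ_self _)
    · rw [extendBy_of_notMem _ _ _ hb]
      exact Nat.lt_succ_self _
  · intro T hT
    obtain ⟨h1, hs⟩ := Finset.mem_filter.mp hT
    obtain ⟨hT, hTe⟩ := mem_tableauxBelow.mp h1
    exact hext T hT hTe hs
  · intro T hT
    funext b
    exact extendBy_of_mem T e ⟨b.1, hsub b.2⟩ b.2
  · intro T hT
    obtain ⟨h1, hs⟩ := Finset.mem_filter.mp hT
    obtain ⟨hT, hTe⟩ := mem_tableauxBelow.mp h1
    rw [← prod_weight_extendBy x y huκ hκl, hext T hT hTe hs]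

/-- Removing the largest letter `e` from the tableaux: `K` is the set of the shapes that can
remain. -/
theorem tableauxSum_succ {n m : ℕ} (x y : Fin m → R) {l u : Fin n → ℕ} (e : Letter m)
    (K : Finset (Fin n → ℕ))
    (hK : ∀ κ, κ ∈ K → IsStrictPartition κ ∧ (∀ i, κ i ≤ l i) ∧
      (e.IsPlain → ∀ i j : Fin n, i < j → l j ≠ 0 → (j : ℕ) + l j ≤ i + κ i) ∧
      (e.IsPrimed → ∀ i, l i ≤ κ i + 1))
    (hmem : (∀ i, u i ≤ l i) → ∀ T ∈ tableauxBelow l u m (e.rank + 1), shapeBelow T e.rank ∈ K) :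
    tableauxSum x y l u (e.rank + 1) =
      ∑ κ ∈ K, (∏ i, (e.weight x y) ^ (l i - κ i)) * tableauxSum x y κ u e.rank := by
  by_cases hul : ∀ i, u i ≤ l i
  · rw [tableauxSum, if_pos hul, ← Finset.sum_fiberwise_of_maps_to (hmem hul)]
    refine Finset.sum_congr rfl fun κ hκ => ?_
    obtain ⟨h1, h2, h3, h4⟩ := hK κ hκ
    by_cases huκ : ∀ i, u i ≤ κ i
    · rw [tableauxSum, if_pos huκ]
      exact sum_fiber_shapeBelow x y h1 hul huκ h2 e h3 h4
    -- A strip may cut into `u`; the zero convention in `tableauxSum` matches the empty fibre here.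
    · rw [tableauxSum, if_neg huκ, mul_zero, Finset.filter_eq_empty_iff.mpr, Finset.sum_empty]
      intro T _ hs
      exact huκ fun i => hs ▸ le_shapeBelow _ i
  · rw [tableauxSum, if_neg hul]
    refine (Finset.sum_eq_zero fun κ hκ => ?_).symm
    rw [tableauxSum, if_neg fun h => hul fun i => (h i).trans ((hK κ hκ).2.1 i), mul_zero]

theorem tableauxSum_plain {n m : ℕ} (x y : Fin m → R) {l u : Fin n → ℕ} (hu : IsStrictPartition u)
    (hl : IsStrictPartition l) (e : Letter m) (he : e.IsPlain) :
    tableauxSum x y l u (e.rank + 1) =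
      ∑ κ ∈ hStrips l, (∏ i, (e.weight x y) ^ (l i - κ i)) * tableauxSum x y κ u e.rank := by
  refine tableauxSum_succ x y e _ (fun κ hκ => ?_) fun hul T hT => ?_
  · obtain ⟨h1, h2, h3⟩ := (mem_hStrips_iff hl κ).mp hκ
    exact ⟨h1, h2, fun _ => h3, fun h => absurd (he.symm.trans h) (by simp)⟩
  · obtain ⟨hT, hTe⟩ := mem_tableauxBelow.mp hT
    exact (mem_hStrips_iff hl _).mpr ⟨isStrictPartition_shapeBelow hu hl hul hT _,
      shapeBelow_le hul _, shapeBelow_hStrip hu hl hul hT he hTe⟩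

theorem tableauxSum_primed {n m : ℕ} (x y : Fin m → R) {l u : Fin n → ℕ} (hu : IsStrictPartition u)
    (hl : IsStrictPartition l) (e : Letter m) (he : e.IsPrimed) :
    tableauxSum x y l u (e.rank + 1) =
      ∑ κ ∈ vStrips l, (∏ i, (e.weight x y) ^ (l i - κ i)) * tableauxSum x y κ u e.rank := by
  refine tableauxSum_succ x y e _ (fun κ hκ => ?_) fun hul T hT => ?_
  · obtain ⟨h1, h2, h3⟩ := (mem_vStrips_iff l κ).mp hκ
    exact ⟨h1, h2, fun h => absurd (he.symm.trans h) (by simp), fun _ => h3⟩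
  · obtain ⟨hT, hTe⟩ := mem_tableauxBelow.mp hT
    exact (mem_vStrips_iff l _).mpr ⟨isStrictPartition_shapeBelow hu hl hul hT _,
      shapeBelow_le hul _, shapeBelow_vStrip hT he hTe⟩

theorem tableauxSum_zero {n m : ℕ} (x y : Fin m → R) (l u : Fin n → ℕ) :
    tableauxSum x y l u 0 = if u = l then 1 else 0 := by
  by_cases h : u = l
  · subst h
    have he : IsEmpty (shiftedSkewShape u u) := ⟨fun b => by
      have := mem_shiftedSkewShape.mp b.2; omega⟩
    have h1 : tableauxBelow u u m 0 = {fun b => he.elim b} := by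
      ext T
      rw [mem_tableauxBelow, Finset.mem_singleton]
      exact ⟨fun _ => Subsingleton.elim _ _, fun _ => ⟨⟨fun b => he.elim b, fun b => he.elim b,
        fun b => he.elim b, fun b => he.elim b⟩, fun b => he.elim b⟩⟩
    rw [tableauxSum, if_pos fun _ => le_rfl, h1, Finset.sum_singleton, if_pos rfl,
      Fintype.prod_empty]
  · rw [if_neg h]
    by_cases hul : ∀ i, u i ≤ l i
    · rw [tableauxSum, if_pos hul]
      obtain ⟨i, hi⟩ := Function.ne_iff.mp h
      refine Finset.sum_eq_zero fun T hT => absurd ((mem_tableauxBelow.mp hT).2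
        ⟨⟨i, i + u i⟩, mem_shiftedSkewShape.mpr ?_⟩) (Nat.not_lt_zero _)
      have := hul i
      simp only
      omega
    · rw [tableauxSum, if_neg hul]

/-! ### Comparison of the two recursions. -/

section Main

variable {m : ℕ}

/-- The product of the first `k` factors of `quotientSeries x y`. -/
noncomputable def partialSeries (x y : Fin m → R) (k : ℕ) : R⟦X⟧ :=
  ∏ i ∈ Finset.univ.filter (fun i : Fin m => (i : ℕ) < k),
    (1 + PowerSeries.C (y i) * PowerSeries.X) *
      PowerSeries.invOfUnit (1 - PowerSeries.C (x i) * PowerSeries.X) 1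

theorem partialSeries_succ (x y : Fin m → R) (k : Fin m) :
    partialSeries x y (k + 1) = (partialSeries x y k +
      PowerSeries.C (y k) * PowerSeries.X * partialSeries x y k) +
        PowerSeries.C (x k) * PowerSeries.X * partialSeries x y (k + 1) := by
  have h1 : Finset.univ.filter (fun i : Fin m => (i : ℕ) < k + 1) =
      insert k (Finset.univ.filter fun i : Fin m => (i : ℕ) < k) := by
    ext i
    simp only [Finset.mem_filter, Finset.mem_univ, true_and, Finset.mem_insert, Fin.ext_iff]
    omega
  have h2 : partialSeries x y (k + 1) = ((1 + PowerSeries.C (y k) * PowerSeries.X) *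
      PowerSeries.invOfUnit (1 - PowerSeries.C (x k) * PowerSeries.X) 1) * partialSeries x y k := by
    rw [partialSeries, h1, Finset.prod_insert (by simp)]
    rfl
  have h3 : (1 - PowerSeries.C (x k) * PowerSeries.X) *
      PowerSeries.invOfUnit (1 - PowerSeries.C (x k) * PowerSeries.X) 1 = 1 :=
    PowerSeries.mul_invOfUnit _ _ (by simp)
  rw [h2]
  linear_combination (1 + PowerSeries.C (y k) * PowerSeries.X) * partialSeries x y k * h3

/-- The diagonal is unchanged by each factor, and for the empty product it is zero. -/
theorem pf₂_partialSeries (z : R) {x y : Fin m → R} (hy : ∀ i, y i = x i + z) (k : ℕ) (hk : k ≤ m)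
    (p : ℤ) (hp : 0 < p) : pf₂ z p p (partialSeries x y k) (partialSeries x y k) = 0 := by
  induction k with
  | zero => simpa [partialSeries] using pf₂_one z hp p
  | succ k ih =>
    rw [← ih (by omega)]
    refine pf₂_diag_eq (x := x ⟨k, hk⟩) ?_ (p + 1).toNat p (by omega)
    have h := partialSeries_succ x y ⟨k, hk⟩
    simp only [hy ⟨k, hk⟩] at h
    rw [map_neg]
    linear_combination h

/-- Containment of `u` in `l` is not assumed, since the shapes met in the induction need not contain
`u`. -/
theorem skewPf_partialSeries (z : R) {n : ℕ} {u : Fin n → ℕ} (hu : IsStrictPartition u)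
    {x y : Fin m → R} (hy : ∀ i, y i = x i + z) (k : ℕ) (hk : k ≤ m) (l : Fin n → ℕ)
    (hl : IsStrictPartition l) :
    skewPf z (fun i => (l i : ℤ)) u (fun _ => partialSeries x y k) =
      tableauxSum x y l u (2 * k) := by
  induction k generalizing l with
  | zero =>
    have : partialSeries x y 0 = 1 := by simp [partialSeries]
    rw [this, skewPf_one z hl hu, tableauxSum_zero]
  | succ k ih =>
    set q : Fin m := ⟨k, hk⟩ with hq
    have h1 : 2 * (k + 1) = Letter.rank (toLex (q, true)) + 1 := by simp [Letter.rank, hq]; ring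
    have h2 : Letter.rank (toLex (q, true)) = Letter.rank (toLex (q, false)) + 1 := by
      simp [Letter.rank]
    have h3 : Letter.rank (toLex (q, false)) = 2 * k := by simp [Letter.rank, hq]
    -- The plain letter, being larger, goes first. The diagonal condition is needed for the partial
    -- products before and after the factor, but not for the intermediate series $(1+yt)c$.
    rw [h1, tableauxSum_plain x y hu hl (toLex (q, true)) rfl, skewPf_eq_sum_hStrips z (x q) hu hl _ _
      (partialSeries_succ x y q) (pf₂_partialSeries z hy _ hk)]
    refine Finset.sum_congr rfl fun κ hκ => ?_
    have hκ' := isStrictPartition_of_mem_hStrips hl hκ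
    rw [h2, tableauxSum_primed x y hu hκ' (toLex (q, false)) rfl, skewPf_eq_sum_vStrips z (y q) hu hκ' _ _ rfl
      (pf₂_partialSeries z hy _ (by omega)), h3]
    congr 1
    refine Finset.sum_congr rfl fun ν hν => ?_
    rw [ih (by omega) ν ((mem_vStrips_iff κ ν).mp hν).1]
    rfl

end Main

end SchurPf

theorem mainTheorem11 {R : Type*} [CommRing R] (z : R) (n : ℕ) (l u : Fin n → ℕ)
    (hl : SchurPf.IsStrictPartition l) (hu : SchurPf.IsStrictPartition u)
    (hul : ∀ i, u i ≤ l i) (m : ℕ) (x y : Fin m → R) (hy : ∀ i, y i = x i + z) :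
    SchurPf.skewPf z (fun i => (l i : ℤ)) u (fun _ => SchurPf.quotientSeries x y) =
      ∑ T ∈ SchurPf.tableaux l u m, ∏ b, SchurPf.Letter.weight x y (T b) := by
  have h1 : SchurPf.quotientSeries x y = SchurPf.partialSeries x y m := by
    simp [SchurPf.quotientSeries, SchurPf.partialSeries]
  have h2 : SchurPf.tableauxBelow l u m (2 * m) = SchurPf.tableaux l u m :=
    Finset.filter_true_of_mem fun T _ b => (T b).rank_lt
  rw [h1, SchurPf.skewPf_partialSeries z hu hy m le_rfl l hl, SchurPf.tableauxSum, if_pos hul, h2]
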